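/- Let $\mathbb{H}$ be the upper half-plane, let $$\Gamma_0^*(3) := \Gamma_0(3)\,\cup\,\Gamma_0(3)W_3,\qquad W_3 := \begin{pmatrix} 0 & -1/\sqrt3\\ \sqrt3 & 0\end{pmatrix},$$ where $\Gamma_0(3)$ is the group of matrices $\begin{pmatrix} a&b\\c&d\end{pmatrix}\in \mathrm{SL}_2(\mathbb{Z})$ with $3\mid c$, and let $k$ be an integer. A modular function of weight $k$ for $\Gamma_0^*(3)$ is a meromorphic function $f$ on $\mathbb{H}$ such that $f\left(\frac{az+b}{cz+d}\right)=(cz+d)^k f(z)$ for all $\begin{pmatrix} a&b\\c&d\end{pmatrix}\in\Gamma_0^*(3)$, and which is meromorphic at $\infty$, i.e. which is, as a function of $q=e^{2\pi i z}$, meromorphic at $q=0$. For $p\in\mathbb{H}$ let $v_p(f)$ be the order of $f$ at $p$ (it depends only on the orbit $\Gamma_0^*(3)p$), and let $v_\infty(f)$ be the order of $f$ at $q=0$ as a function of $q$. Let $f$ be a modular function of weight $k$ for $\Gamma_0^*(3)$ which is not identically zero. Then all the orders $v_\infty(f)$ and $v_p(f)$ are finite, $v_p(f)\neq 0$ for only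 finitely many $p\in\Gamma_0^*(3)\backslash\mathbb{H}$, and $$v_\infty(f)+\frac12\, v_{i/\sqrt3}(f)+\frac16\, v_{\rho_3}(f)+\sum_{\substack{p\in\Gamma_0^*(3)\backslash\mathbb{H}\\ p\neq i/\sqrt3,\ \rho_3}} v_p(f)=\frac k6,$$ where $\rho_3 := e^{5\pi i/6}/\sqrt3$, and where $p\neq i/\sqrt3,\ \rho_3$ means that $p$ is neither the orbit of $i/\sqrt3$ nor that of $\rho_3$. -/

import Mathlib

open UpperHalfPlane ModularForm CongruenceSubgroup
open scoped MatrixGroups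

namespace Fricke

/-- The Fricke matrix `W_p = (0, -1/√p; √p, 0)`. -/
noncomputable def W (p : ℕ) [Fact p.Prime] : GL (Fin 2) ℝ :=
  Matrix.GeneralLinearGroup.mkOfDetNeZero !![0, -1 / √(p : ℝ); √(p : ℝ), 0] (by
    have : √(p : ℝ) ≠ 0 :=
      Real.sqrt_ne_zero'.2 (Nat.cast_pos.2 (Fact.out : p.Prime).pos)
    simp [Matrix.det_fin_two, this])

theorem W_apply (p : ℕ) [Fact p.Prime] :
    (W p : Matrix (Fin 2) (Fin 2) ℝ) = !![0, -1 / √(p : ℝ); √(p : ℝ), 0] := rfl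

/-- An element of `SL₂(ℤ)`, seen as a real matrix. -/
abbrev toReal (γ : SL(2, ℤ)) : GL (Fin 2) ℝ := Matrix.SpecialLinearGroup.mapGL ℝ γ

theorem toReal_mul (γ δ : SL(2, ℤ)) : toReal (γ * δ) = toReal γ * toReal δ := map_mul _ _ _

theorem toReal_apply (γ : SL(2, ℤ)) :
    (toReal γ : Matrix (Fin 2) (Fin 2) ℝ) = !![(γ 0 0 : ℝ), γ 0 1; γ 1 0, γ 1 1] := by
  ext i j
  fin_cases i <;> fin_cases j <;> simp [toReal]

theorem W_mul_W (p : ℕ) [Fact p.Prime] : W p * W p = toReal (-1) := by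
  have : √(p : ℝ) ≠ 0 :=
    Real.sqrt_ne_zero'.2 (Nat.cast_pos.2 (Fact.out : p.Prime).pos)
  ext i j
  fin_cases i <;> fin_cases j <;>
    simp [W_apply, Matrix.mul_apply, this, neg_div]

theorem W_mul_Gamma0 (p : ℕ) [Fact p.Prime] (γ : SL(2, ℤ)) (hγ : γ ∈ Gamma0 p) :
    ∃ δ ∈ Gamma0 p, W p * toReal γ = toReal δ * W p := by
  have hp : √(p : ℝ) ≠ 0 :=
    Real.sqrt_ne_zero'.2 (Nat.cast_pos.2 (Fact.out : p.Prime).pos)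
  have hsq : √(p : ℝ) * √(p : ℝ) = p := Real.mul_self_sqrt (Nat.cast_nonneg p)
  obtain ⟨c, hc⟩ := (ZMod.intCast_zmod_eq_zero_iff_dvd _ p).1 (Gamma0_mem.1 hγ)
  have hdet := γ.det_coe
  rw [Matrix.det_fin_two, hc] at hdet
  obtain ⟨δ, hδ⟩ : ∃ δ : SL(2, ℤ),
      (δ : Matrix (Fin 2) (Fin 2) ℤ) = !![γ 1 1, -c; -p * γ 0 1, γ 0 0] :=
    ⟨⟨!![γ 1 1, -c; -p * γ 0 1, γ 0 0], by rw [Matrix.det_fin_two_of]; linarith⟩, rfl⟩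
  refine ⟨δ, ?_, ?_⟩
  · rw [Gamma0_mem, hδ]; simp
  · apply Units.ext
    rw [Units.val_mul, Units.val_mul, toReal_apply, toReal_apply, hδ, W_apply, hc,
      Matrix.mul_fin_two, Matrix.mul_fin_two]
    ext i j
    fin_cases i <;> fin_cases j <;> simp
    · field_simp
      linear_combination (c : ℝ) * hsq
    · field_simp
    · ring
    · field_simp
      linear_combination (γ 0 1 : ℝ) * hsq

/-- The Fricke group `Γ₀*(p) = Γ₀(p) ∪ Γ₀(p) W_p`, as a group of real matrices. -/
noncomputable def Gamma0Star (p : ℕ) [Fact p.Prime] : Subgroup (GL (Fin 2) ℝ) where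
  carrier := {g | (∃ γ ∈ Gamma0 p, g = toReal γ) ∨ ∃ γ ∈ Gamma0 p, g = toReal γ * W p}
  one_mem' := Or.inl ⟨1, one_mem _, by simp⟩
  mul_mem' := by
    rintro _ _ (⟨a, ha, rfl⟩ | ⟨a, ha, rfl⟩) (⟨b, hb, rfl⟩ | ⟨b, hb, rfl⟩)
    · exact Or.inl ⟨a * b, mul_mem ha hb, by simp⟩
    · exact Or.inr ⟨a * b, mul_mem ha hb, by simp [mul_assoc]⟩
    · obtain ⟨d, hd, h⟩ := W_mul_Gamma0 p b hb
      exact Or.inr ⟨a * d, mul_mem ha hd, by rw [mul_assoc, h, toReal_mul, mul_assoc]⟩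
    · obtain ⟨d, hd, h⟩ := W_mul_Gamma0 p b hb
      refine Or.inl ⟨a * d * (-1), mul_mem (mul_mem ha hd) (by simp [Gamma0_mem]), ?_⟩
      rw [mul_assoc, ← mul_assoc (W p), h, mul_assoc, W_mul_W, toReal_mul, toReal_mul, mul_assoc]
  inv_mem' := by
    rintro _ (⟨a, ha, rfl⟩ | ⟨a, ha, rfl⟩)
    · exact Or.inl ⟨a⁻¹, inv_mem ha, by simp⟩
    · obtain ⟨d, hd, h⟩ := W_mul_Gamma0 p a⁻¹ (inv_mem ha)
      refine Or.inr ⟨(-1) * d, mul_mem (by simp [Gamma0_mem]) hd, ?_⟩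
      rw [inv_eq_iff_mul_eq_one, toReal_mul, mul_assoc (toReal (-1)), ← h, ← W_mul_W p]
      have hW : W p * W p * (W p * W p) = 1 := by rw [W_mul_W, ← toReal_mul]; simp
      calc toReal a * W p * (W p * W p * (W p * toReal a⁻¹))
          = toReal a * (W p * W p * (W p * W p)) * toReal a⁻¹ := by simp only [mul_assoc]
        _ = 1 := by rw [hW, mul_one, ← toReal_mul]; simp

theorem det_eq_one {p : ℕ} [Fact p.Prime] {g : GL (Fin 2) ℝ} (hg : g ∈ Gamma0Star p) :
    g.val.det = 1 := by
  have hp : √(p : ℝ) ≠ 0 :=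
    Real.sqrt_ne_zero'.2 (Nat.cast_pos.2 (Fact.out : p.Prime).pos)
  have hW : (W p).val.det = 1 := by
    rw [W_apply, Matrix.det_fin_two_of]; field_simp; norm_num
  have hγ : ∀ γ : SL(2, ℤ), (toReal γ).val.det = 1 := fun γ ↦ by
    have := γ.det_coe
    rw [Matrix.det_fin_two] at this
    rw [toReal_apply, Matrix.det_fin_two_of]
    exact_mod_cast this
  obtain ⟨γ, -, rfl⟩ | ⟨γ, -, rfl⟩ := hg
  · exact hγ γ
  · rw [Units.val_mul, Matrix.det_mul, hγ, hW, one_mul]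

/-- A modular function of weight `k` for `Γ₀*(p)`: a function on the upper half-plane which
* satisfies `f (γ z) = (c z + d) ^ k f z` for all `γ = (a, b; c, d)` in `Γ₀*(p)`,
* is meromorphic on the upper half-plane,
* is meromorphic at infinity: as a function of `q = exp (2 π i z)` it is meromorphic at `q = 0`.

Meromorphic functions are total functions here. The value at a pole is a convention: one may always
take it to be `0`, which is compatible with the transformation law. -/
structure ModularFunction (p : ℕ) [Fact p.Prime] (k : ℤ) extends
    SlashInvariantForm (Gamma0Star p) k where
  meromorphic : ∀ τ : ℍ, MeromorphicAt (fun z : ℂ ↦ toFun (ofComplex z)) (τ : ℂ)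
  meromorphic_infty : MeromorphicAt (cuspFunction 1 toFun) 0

namespace ModularFunction

variable {p : ℕ} [Fact p.Prime] {k : ℤ}

/-- `f` is identically zero as a meromorphic function: it vanishes off a closed discrete set. -/
def IsZero (f : ModularFunction p k) : Prop :=
  f.toFun =ᶠ[Filter.codiscrete ℍ] 0

/-- The order `v_τ(f)` at a point of the upper half-plane (`⊤` if `f` vanishes around `τ`). -/
noncomputable def orderAt (f : ModularFunction p k) (τ : ℍ) : WithTop ℤ :=
  meromorphicOrderAt (fun z : ℂ ↦ f.toFun (ofComplex z)) (τ : ℂ)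

/-- The order `v_∞(f)`: the order at `q = 0` of `f` as a function of `q = exp (2 π i z)`. -/
noncomputable def orderAtInfty (f : ModularFunction p k) : WithTop ℤ :=
  meromorphicOrderAt (cuspFunction 1 f.toFun) 0

theorem orderAt_smul (f : ModularFunction p k) (g : Gamma0Star p) (τ : ℍ) :
    f.orderAt (g • τ) = f.orderAt τ := by
  have hdet := det_eq_one g.2
  have hpos : 0 < (g : GL (Fin 2) ℝ).val.det := by rw [hdet]; exact one_pos
  have hlaw : ∀ σ : ℍ, f.toFun ((g : GL (Fin 2) ℝ) • σ) =
      denom (g : GL (Fin 2) ℝ) σ ^ k * f.toFun σ := fun σ ↦ by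
    have h := congrFun (f.slash_action_eq' g g.2) σ
    have hd : (g : GL (Fin 2) ℝ).det.val = 1 := hdet
    rw [slash_def] at h
    simp only [UpperHalfPlane.σ, hd, one_pos, if_true, abs_one, Complex.ofReal_one, one_zpow,
      mul_one] at h
    rw [← h]
    have := zpow_ne_zero k (denom_ne_zero (g : GL (Fin 2) ℝ) σ)
    rw [zpow_neg]
    field_simp
    simp
  change meromorphicOrderAt (fun z : ℂ ↦ f.toFun (ofComplex z))
    (((g : GL (Fin 2) ℝ) • τ : ℍ) : ℂ) = _
  rw [← meromorphicOrderAt_comp_smul hpos, orderAt]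
  have han : AnalyticAt ℂ (fun z : ℂ ↦ denom (g : GL (Fin 2) ℝ) z ^ k) (τ : ℂ) := by
    have : AnalyticAt ℂ (fun z : ℂ ↦ denom (g : GL (Fin 2) ℝ) z) (τ : ℂ) := by
      unfold denom; fun_prop
    exact this.zpow (denom_ne_zero _ τ)
  have hnz : denom (g : GL (Fin 2) ℝ) (τ : ℂ) ^ k ≠ 0 := zpow_ne_zero k (denom_ne_zero _ τ)
  have hord : meromorphicOrderAt (fun z : ℂ ↦ denom (g : GL (Fin 2) ℝ) z ^ k) (τ : ℂ) = 0 := by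
    rw [han.meromorphicOrderAt_eq, han.analyticOrderAt_eq_zero.2 hnz]; rfl
  have hmul := meromorphicOrderAt_mul han.meromorphicAt (f.meromorphic τ)
  rw [hord, zero_add] at hmul
  rw [← hmul]
  apply meromorphicOrderAt_congr
  filter_upwards [nhdsWithin_le_nhds (isOpen_upperHalfPlaneSet.mem_nhds τ.im_pos)] with z hz
  rw [hlaw]
  simp [ofComplex_apply_of_im_pos hz]

/-- The order `v_P(f)` at a point `P` of the quotient `Γ₀*(p) \ ℍ`, that is, the order at any
point of the orbit. -/
noncomputable def orderAtOrbit (f : ModularFunction p k)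
    (P : MulAction.orbitRel.Quotient (Gamma0Star p) ℍ) : WithTop ℤ :=
  Quotient.lift (s := MulAction.orbitRel (Gamma0Star p) ℍ) f.orderAt (by
    rintro a b ⟨g, rfl⟩
    exact f.orderAt_smul g b) P

end ModularFunction

/-- The orbit of `τ`, a point of `Γ₀*(p) \ ℍ`. -/
noncomputable def orbit (p : ℕ) [Fact p.Prime] (τ : ℍ) : MulAction.orbitRel.Quotient (Gamma0Star p) ℍ :=
  Quotient.mk (MulAction.orbitRel (Gamma0Star p) ℍ) τ

/-- The point `i / √3`. -/
noncomputable def i₃ : ℍ := ⟨Complex.I / (√3 : ℝ), by simp⟩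

/-- The point `ρ₃ = exp (i (5 π / 6)) / √3`. -/
noncomputable def ρ₃ : ℍ :=
  ⟨Complex.exp (Complex.I * ((5 * Real.pi / 6 : ℝ) : ℂ)) / (√3 : ℝ), by
    rw [mul_comm, Complex.div_ofReal_im, Complex.exp_ofReal_mul_I_im]
    have := Real.sin_pos_of_pos_of_lt_pi (x := 5 * Real.pi / 6) (by positivity)
      (by linarith [Real.pi_pos])
    positivity⟩

end Fricke

open Filter Topology
open scoped Manifold

/-! ### The action of `Γ₀*(p)` on the upper half-plane -/

namespace Fricke

/-! No contour integral is used. The quotient `Γ₀*(3) \ ℍ` is uniformized by a Hauptmodul `t`, an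
invariant holomorphic function with a simple pole at the cusp, and `f` is compared with an explicit
product having the same zeros and poles.

Existence of `t`: with `E₄` and `Δ` at `τ` and `3τ` one forms `formEight`, of weight 8 up to a
sign-free Fricke factor and of order 1 in `q`, and `discr = Δ(τ) Δ(3τ)`, of weight 24, without zeros
on `ℍ` and of order 4 in `q`. Then `t = formEight³ / discr` has weight 0 and order `3 - 4 = -1`.

Injectivity of `t` on orbits (`IsHauptmodul.not_repeated`): the closure of the set of values taken
in two different orbits is open, closed and bounded in `ℂ`, hence empty. Consequently the order of
`t - t P` at `P` is the number of multipliers `(c P + d)⁻²` of the stabilizer of `P`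
(`IsHauptmodul.exists_order_iff`): it is 2 on the orbit of `i₃`, 6 on that of `ρ₃` and 1 elsewhere.

Conclusion (`ModularFunction.valence_formula`): let `e_P` be this order. The function `f²⁴ · discr⁻ᵏ
· ∏ (t - t P)^(-(24 / e_P) v_P(f))` has weight 0 and order 0 at every point of `ℍ`. By the maximum
principle, applied to it and to its inverse, its order at the cusp is 0 too. That order is `24
v_∞(f) - 4k + ∑ (24 / e_P) v_P(f)`; dividing by 24 gives the formula. -/

theorem toReal_mem_Gamma0Star {p : ℕ} [Fact p.Prime] {γ : SL(2, ℤ)} (hγ : γ ∈ Gamma0 p) :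
    toReal γ ∈ Gamma0Star p := Or.inl ⟨γ, hγ, rfl⟩

theorem W_mem_Gamma0Star (p : ℕ) [Fact p.Prime] : W p ∈ Gamma0Star p :=
  Or.inr ⟨1, one_mem _, by simp⟩

theorem T_zpow_mem_Gamma0 (p : ℕ) (n : ℤ) : ModularGroup.T ^ n ∈ Gamma0 p := by
  simp [Gamma0_mem, ModularGroup.coe_T_zpow]

/-- Reduction to `SL₂(ℤ)`: `γ W` moves `K` to meet `L` exactly when `γ` moves the compact set `W K`
to meet `L`. -/
instance properlyDiscontinuousSMul_Gamma0Star (p : ℕ) [Fact p.Prime] :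
    ProperlyDiscontinuousSMul (Gamma0Star p) ℍ := by
  have h : ProperlyDiscontinuousSMul 𝒮ℒ ℍ := inferInstance
  rw [Subgroup.properlyDiscontinuousSMul_iff] at h ⊢
  intro K L hK hL
  have hWK : IsCompact ((W p • ·) '' K) := hK.image (continuous_const_smul _)
  refine ((h hK hL).union ((h hWK hL).image (· * W p))).subset ?_
  rintro g ⟨⟨γ, hγ, rfl⟩ | ⟨γ, hγ, rfl⟩, x, ⟨y, hy, rfl⟩, hx⟩
  · exact Or.inl ⟨⟨γ, rfl⟩, _, ⟨y, hy, rfl⟩, hx⟩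
  · refine Or.inr ⟨toReal γ, ⟨⟨γ, rfl⟩, _, ⟨_, ⟨y, hy, rfl⟩, rfl⟩, ?_⟩, rfl⟩
    simpa only [mul_smul] using hx

/-- Explicit form of the elements of `Γ₀*(3)`. -/
theorem exists_entries {g : GL (Fin 2) ℝ} (hg : g ∈ Gamma0Star 3) :
    ∃ a b c d : ℤ, a * d - 3 * b * c = 1 ∧
      (g.val = !![(a : ℝ), b; 3 * c, d] ∨ g.val = !![√3 * b, -(√3 * a / 3); √3 * d, -(√3 * c)]) := by
  have hsq : √(3 : ℝ) * √3 = 3 := Real.mul_self_sqrt (by norm_num)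
  have h0 : √(3 : ℝ) ≠ 0 := by positivity
  have key : ∀ γ ∈ Gamma0 3, ∃ a b c d : ℤ, a * d - 3 * b * c = 1 ∧
      (toReal γ).val = !![(a : ℝ), b; 3 * c, d] := by
    intro γ hγ
    obtain ⟨c, hc⟩ := (ZMod.intCast_zmod_eq_zero_iff_dvd _ 3).1 (Gamma0_mem.1 hγ)
    have hdet := γ.det_coe
    rw [Matrix.det_fin_two, hc] at hdet
    refine ⟨γ 0 0, γ 0 1, c, γ 1 1, by push_cast at hdet; linarith, ?_⟩
    rw [toReal_apply, hc]
    push_cast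
    rfl
  obtain ⟨γ, hγ, rfl⟩ | ⟨γ, hγ, rfl⟩ := hg
  · obtain ⟨a, b, c, d, h, h'⟩ := key γ hγ
    exact ⟨a, b, c, d, h, Or.inl h'⟩
  · obtain ⟨a, b, c, d, h, h'⟩ := key γ hγ
    refine ⟨a, b, c, d, h, Or.inr ?_⟩
    rw [Units.val_mul, h', W_apply, Matrix.mul_fin_two]
    ext i j
    fin_cases i <;> fin_cases j <;> simp <;> field_simp <;> norm_num [mul_comm]

theorem coe_W_smul (τ : ℍ) : ((W 3 • τ : ℍ) : ℂ) = -1 / (3 * τ) := by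
  have hsq : (√(3 : ℝ) : ℂ) * √3 = 3 := by
    rw [← Complex.ofReal_mul, Real.mul_self_sqrt (by norm_num)]; simp
  have h0 : (√(3 : ℝ) : ℂ) ≠ 0 := by
    rw [Ne, Complex.ofReal_eq_zero]; positivity
  have hτ := τ.ne_zero
  rw [coe_smul_of_det_pos (by
    rw [Matrix.GeneralLinearGroup.val_det_apply, det_eq_one (W_mem_Gamma0Star 3)]; exact one_pos)]
  simp [num, denom, W_apply]
  field_simp
  linear_combination hsq

theorem denom_W (τ : ℍ) : denom (W 3) τ = √3 * τ := by
  simp [denom, W_apply]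

theorem exists_translation (p : ℕ) [Fact p.Prime] (n : ℤ) :
    ∃ g ∈ Gamma0Star p, ∀ τ : ℍ, g • τ = (n : ℝ) +ᵥ τ :=
  ⟨_, toReal_mem_Gamma0Star (T_zpow_mem_Gamma0 p n), fun τ ↦ modular_T_zpow_smul τ n⟩

/-! ### The fundamental domain of `Γ₀*(3)` -/

/-- The (closed) standard fundamental domain of `Γ₀*(3)`. -/
def fundDomain : Set ℍ := {τ | |τ.re| ≤ 1 / 2 ∧ 1 / 3 ≤ Complex.normSq τ}

/-- Move `τ` to `w` in the domain of `SL₂(ℤ)`. The four cosets of `Γ₀(3)` correspond to the points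
of the projective line over `𝔽₃`: one gives `w` itself, the other three give `-1 / (w + j)` with `j`
in `{0, 1, -1}`. -/
theorem exists_smul_mem_fundDomain (τ : ℍ) : ∃ g ∈ Gamma0Star 3, g • τ ∈ fundDomain := by
  obtain ⟨γ, hγ⟩ := ModularGroup.exists_smul_mem_fd τ
  set w := γ • τ with hw
  obtain ⟨h1, h2⟩ := hγ
  have hτ : τ = γ⁻¹ • w := by rw [hw, inv_smul_smul]
  have hy := w.im_pos
  rw [abs_le] at h2
  have h1' : 1 ≤ w.re * w.re + w.im * w.im := by simpa [Complex.normSq_apply] using h1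
  -- the case `c ≡ 0`
  by_cases hc : ((γ⁻¹ 1 0 : ℤ) : ZMod 3) = 0
  · refine ⟨toReal γ, toReal_mem_Gamma0Star ?_, abs_le.2 h2, le_trans (by norm_num) h1⟩
    simpa using inv_mem (Gamma0_mem.2 hc)
  -- in the other cases `τ` is equivalent to `-1 / (w + j)`
  obtain ⟨j, hj, hjd⟩ : ∃ j : ℤ, (j = 0 ∨ j = 1 ∨ j = -1) ∧
      ((γ⁻¹ 1 1 : ℤ) : ZMod 3) = j * ((γ⁻¹ 1 0 : ℤ) : ZMod 3) := by
    generalize ((γ⁻¹ 1 1 : ℤ) : ZMod 3) = d at *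
    generalize ((γ⁻¹ 1 0 : ℤ) : ZMod 3) = c at *
    have : ∃ j : ℤ, j ∈ ({0, 1, -1} : Finset ℤ) ∧ d = j * c := by
      revert c d; decide
    simpa using this
  have hmem : γ⁻¹ * (ModularGroup.S * ModularGroup.T ^ j)⁻¹ ∈ Gamma0 3 := by
    obtain ⟨δ, hδ⟩ : ∃ δ : SL(2, ℤ), (δ : Matrix (Fin 2) (Fin 2) ℤ) = !![j, 1; -1, 0] :=
      ⟨⟨!![j, 1; -1, 0], by simp [Matrix.det_fin_two_of]⟩, rfl⟩
    have hinv : (ModularGroup.S * ModularGroup.T ^ j)⁻¹ = δ := by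
      refine inv_eq_of_mul_eq_one_right (Subtype.ext ?_)
      rw [Matrix.SpecialLinearGroup.coe_mul, Matrix.SpecialLinearGroup.coe_mul, hδ,
        ModularGroup.coe_T_zpow, ModularGroup.S]
      ext m n
      fin_cases m <;> fin_cases n <;> simp [Matrix.mul_apply, Fin.sum_univ_two]
    rw [Gamma0_mem, hinv, Matrix.SpecialLinearGroup.coe_mul, Matrix.mul_apply, Fin.sum_univ_two, hδ]
    push_cast [Matrix.of_apply, Matrix.cons_val_zero, Matrix.cons_val_one]
    rw [hjd]
    simp
    ring
  set u : ℍ := ModularGroup.S • ((j : ℝ) +ᵥ w) with hu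
  have hgu : ∃ g ∈ Gamma0Star 3, g • τ = u := by
    refine ⟨_, toReal_mem_Gamma0Star (inv_mem hmem), ?_⟩
    change (γ⁻¹ * (ModularGroup.S * ModularGroup.T ^ j)⁻¹)⁻¹ • τ = u
    rw [mul_inv_rev, inv_inv, inv_inv, mul_smul, mul_smul, modular_T_zpow_smul]
  obtain ⟨g, hg, hgτ⟩ := hgu
  have hucoe : (u : ℂ) = -1 / (w + j) := by
    rw [hu, modular_S_smul, coe_mk, coe_vadd]
    have := ((j : ℝ) +ᵥ w).ne_zero
    rw [coe_vadd] at this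
    push_cast at this ⊢
    rw [inv_neg, neg_div, one_div, add_comm]
  have hN : Complex.normSq ((w : ℂ) + j) = (w.re + j) * (w.re + j) + w.im * w.im := by
    simp [Complex.normSq_apply]
  have hNpos : 0 < (w.re + j) * (w.re + j) + w.im * w.im :=
    add_pos_of_nonneg_of_pos (mul_self_nonneg _) (mul_pos hy hy)
  have hNpos' : 0 < Complex.normSq ((w : ℂ) + j) := hN ▸ hNpos
  -- `W 3` exchanges `-1 / (w + j)` and `(w + j) / 3`, and the inside and outside of the circle
  -- `|z|² = 1/3`; the one not inside is chosen.
  by_cases hle : Complex.normSq ((w : ℂ) + j) ≤ 3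
  · refine ⟨g, hg, ?_⟩
    rw [hgτ]
    constructor
    · have : u.re = -(w.re + j) / Complex.normSq ((w : ℂ) + j) := by
        rw [← coe_re, hucoe]; simp [Complex.div_re]
      rw [this, abs_div, abs_neg, abs_of_pos hNpos', div_le_iff₀ hNpos', hN, abs_le]
      rcases hj with rfl | rfl | rfl <;> push_cast <;> constructor <;> nlinarith
    · rw [hucoe, Complex.normSq_div, le_div_iff₀ hNpos']
      simp only [Complex.normSq_neg, map_one]
      linarith
  · refine ⟨W 3 * g, mul_mem (W_mem_Gamma0Star 3) hg, ?_⟩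
    rw [mul_smul, hgτ]
    have hWu : ((W 3 • u : ℍ) : ℂ) = (w + j) / 3 := by
      rw [coe_W_smul, hucoe]
      have := ((j : ℝ) +ᵥ w).ne_zero
      rw [coe_vadd] at this
      push_cast at this
      have : (w : ℂ) + j ≠ 0 := by rwa [add_comm]
      field_simp
    constructor
    · have : (W 3 • u : ℍ).re = (w.re + j) / 3 := by
        rw [← coe_re, hWu]; simp
      rw [this, abs_le]
      rcases hj with rfl | rfl | rfl <;> push_cast <;> constructor <;> linarith
    · rw [hWu, Complex.normSq_div]
      norm_num
      linarith

theorem one_div_twelve_le_im_sq {τ : ℍ} (h : τ ∈ fundDomain) : 1 / 12 ≤ τ.im * τ.im := by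
  have h2 : 1 / 3 ≤ τ.re * τ.re + τ.im * τ.im := by simpa [Complex.normSq_apply] using h.2
  have := abs_le.1 h.1
  nlinarith

/-- `1/4` is a rational number below `√(1/12)`; any positive bound would do for compactness. -/
theorem one_fourth_le_im {τ : ℍ} (h : τ ∈ fundDomain) : 1 / 4 ≤ τ.im := by
  nlinarith [one_div_twelve_le_im_sq h, τ.im_pos]

theorem isCompact_fundDomain_le (Y : ℝ) : IsCompact {τ : ℍ | τ ∈ fundDomain ∧ τ.im ≤ Y} := by
  rw [isEmbedding_coe.isCompact_iff]
  have : ((↑) : ℍ → ℂ) '' {τ : ℍ | τ ∈ fundDomain ∧ τ.im ≤ Y} =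
      (Set.Icc (-(1 / 2)) (1 / 2) ×ℂ Set.Icc (1 / 4) Y) ∩ {z | 1 / 3 ≤ Complex.normSq z} := by
    ext z
    constructor
    · rintro ⟨τ, ⟨h, hY⟩, rfl⟩
      exact ⟨⟨abs_le.1 h.1, one_fourth_le_im h, hY⟩, h.2⟩
    · rintro ⟨⟨h1, h2, h3⟩, h4⟩
      exact ⟨⟨z, lt_of_lt_of_le (by norm_num) h2⟩, ⟨⟨abs_le.2 h1, h4⟩, h3⟩, rfl⟩
  rw [this]
  exact (isCompact_Icc.reProdIm isCompact_Icc).inter_right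
    (isClosed_le continuous_const Complex.continuous_normSq)

theorem det_pos {p : ℕ} [Fact p.Prime] {g : GL (Fin 2) ℝ} (hg : g ∈ Gamma0Star p) :
    0 < g.val.det := by rw [det_eq_one hg]; exact one_pos

/-! ### Elliptic points and their stabilizers -/

theorem re_i₃ : i₃.re = 0 := by
  simp [i₃, ← coe_re]

theorem normSq_i₃ : i₃.re * i₃.re + i₃.im * i₃.im = 1 / 3 := by
  have h : √(3 : ℝ) * √3 = 3 := Real.mul_self_sqrt (by norm_num)
  have : i₃.im = 1 / √3 := by simp [i₃, ← coe_im]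
  rw [re_i₃, this, div_mul_div_comm, h]; norm_num

theorem coe_ρ₃ : (ρ₃ : ℂ) = -1 / 2 + (√3 / 6 : ℝ) * Complex.I := by
  have h : (√(3 : ℝ) : ℂ) * √3 = 3 := by
    rw [← Complex.ofReal_mul, Real.mul_self_sqrt (by norm_num)]; simp
  have h0 : (√(3 : ℝ) : ℂ) ≠ 0 := by rw [Ne, Complex.ofReal_eq_zero]; positivity
  have hc : Real.cos (5 * Real.pi / 6) = -(√3 / 2) := by
    rw [show 5 * Real.pi / 6 = Real.pi - Real.pi / 6 by ring, Real.cos_pi_sub, Real.cos_pi_div_six]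
  have hs : Real.sin (5 * Real.pi / 6) = 1 / 2 := by
    rw [show 5 * Real.pi / 6 = Real.pi - Real.pi / 6 by ring, Real.sin_pi_sub, Real.sin_pi_div_six]
  have : (ρ₃ : ℂ) = Complex.exp (Complex.I * ((5 * Real.pi / 6 : ℝ) : ℂ)) / (√3 : ℝ) := rfl
  rw [this, mul_comm, Complex.exp_mul_I, ← Complex.ofReal_cos, ← Complex.ofReal_sin, hc, hs]
  push_cast
  field_simp
  linear_combination (-2 * Complex.I) * h

theorem re_ρ₃ : ρ₃.re = -1 / 2 := by
  rw [← coe_re, coe_ρ₃]; simp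

theorem normSq_ρ₃ : ρ₃.re * ρ₃.re + ρ₃.im * ρ₃.im = 1 / 3 := by
  have h : √(3 : ℝ) * √3 = 3 := Real.mul_self_sqrt (by norm_num)
  have : ρ₃.im = √3 / 6 := by rw [← coe_im, coe_ρ₃]; simp
  rw [re_ρ₃, this]; linarith

theorem ext_re_normSq {σ τ : ℍ} (h1 : σ.re = τ.re)
    (h2 : σ.re * σ.re + σ.im * σ.im = τ.re * τ.re + τ.im * τ.im) : σ = τ := by
  apply UpperHalfPlane.ext
  apply Complex.ext
  · exact h1
  · have h3 : σ.im * σ.im = τ.im * τ.im := by rw [h1] at h2; linarith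
    exact (mul_self_inj σ.im_pos.le τ.im_pos.le).1 h3

/-- The imaginary part is divided by `|c τ + d|²`, yet unchanged at a fixed point. -/
theorem normSq_denom_of_smul_eq_self {g : GL (Fin 2) ℝ} (hg : g ∈ Gamma0Star 3) {τ : ℍ}
    (h : g • τ = τ) : Complex.normSq (denom g τ) = 1 := by
  have := im_smul_eq_div_normSq g τ
  rw [h, Matrix.GeneralLinearGroup.val_det_apply, det_eq_one hg, abs_one, one_mul,
    eq_div_iff (Complex.normSq_pos.2 (denom_ne_zero g τ)).ne'] at this
  exact mul_left_cancel₀ τ.im_pos.ne' (by rw [this, mul_one])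

/-- `|denom| = 1` together with `im² ≥ 1/12` leaves finitely many bottom rows. For each nontrivial
one, `|re| ≤ 1/2` and `|τ|² ≥ 1/3` force `τ` to be a corner of the domain or the lowest point of its
axis. -/
theorem denom_sq_eq_one_or {g : GL (Fin 2) ℝ} (hg : g ∈ Gamma0Star 3) {τ : ℍ}
    (hτ : τ ∈ fundDomain) (h : g • τ = τ) : denom g τ ^ 2 = 1 ∨
      τ.re * τ.re + τ.im * τ.im = 1 / 3 ∧ (τ.re = 0 ∨ τ.re = 1 / 2 ∨ τ.re = -1 / 2) := by
  have hsq : √(3 : ℝ) * √3 = 3 := Real.mul_self_sqrt (by norm_num)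
  have h0 : (√(3 : ℝ)) ≠ 0 := by positivity
  have hN := normSq_denom_of_smul_eq_self hg h
  have hQ := (gl_smul_eq_self_iff_quadratic (det_pos hg)).1 h
  have hy := one_div_twelve_le_im_sq hτ
  have hy0 := τ.im_pos
  have hx := abs_le.1 hτ.1
  have hxy : 1 / 3 ≤ τ.re * τ.re + τ.im * τ.im := by simpa [Complex.normSq_apply] using hτ.2
  obtain ⟨a, b, c, d, hdet, hform | hform⟩ := exists_entries hg
  · have hden : denom g τ = 3 * c * τ + d := by simp [denom, hform]
    rw [hden, Complex.normSq_apply] at hN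
    simp at hN
    have hc : c ^ 2 < 2 := by
      have : (c : ℝ) ^ 2 < 2 := by
        nlinarith [mul_self_nonneg (3 * c * τ.re + d), mul_nonneg (sq_nonneg (c : ℝ)) (sub_nonneg.2 hy)]
      exact_mod_cast this
    have hc' : c = 0 ∨ c = 1 ∨ c = -1 := by
      have h1 : -2 < c := by nlinarith
      have h2 : c < 2 := by nlinarith
      omega
    rcases hc' with rfl | hc'
    · left
      rw [hden]
      simp at hN
      have : (d : ℂ) * d = 1 := by exact_mod_cast hN
      push_cast
      linear_combination this
    · right
      obtain ⟨s, hs⟩ : ∃ s : ℤ, s = c * d := ⟨_, rfl⟩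
      have hN' : 9 * (τ.re * τ.re + τ.im * τ.im) + 6 * τ.re * s + s * s = 1 := by
        rw [hs]; push_cast
        rcases hc' with rfl | rfl <;> push_cast at hN ⊢ <;> linarith
      -- No integer lies strictly between 1 and 2. Since `|3τ + s|² = 1` and `|τ|² ≥ 1/3`, these
      -- signs force equality in `|re| ≤ 1/2`.
      have hint : 0 ≤ (s - 1) * (s - 2) ∧ 0 ≤ (s + 1) * (s + 2) := by
        constructor
        · rcases le_or_gt s 1 with h | h
          · exact mul_nonneg_of_nonpos_of_nonpos (by omega) (by omega)
          · exact mul_nonneg (by omega) (by omega)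
        · rcases le_or_gt s (-2) with h | h
          · exact mul_nonneg_of_nonpos_of_nonpos (by omega) (by omega)
          · exact mul_nonneg (by omega) (by omega)
      have hint1 : (0 : ℝ) ≤ (s - 1) * (s - 2) := by exact_mod_cast hint.1
      have hint2 : (0 : ℝ) ≤ (s + 1) * (s + 2) := by exact_mod_cast hint.2
      have hs0 : s ≠ 0 := by
        rintro rfl
        simp at hN'
        linarith
      rcases lt_or_gt_of_ne hs0 with hlt | hlt
      · have hlt' : (s : ℝ) ≤ -1 := by exact_mod_cast Int.le_sub_one_of_lt hlt
        have hxe : τ.re = 1 / 2 := by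
          by_contra hne
          have : 0 < 1 / 2 - τ.re := by
            rcases lt_or_eq_of_le hx.2 with h | h
            · linarith
            · exact absurd h hne
          nlinarith
        refine ⟨?_, Or.inr (Or.inl hxe)⟩
        rw [hxe] at hN' hxy ⊢
        nlinarith
      · have hlt' : (1 : ℝ) ≤ s := by exact_mod_cast hlt
        have hxe : τ.re = -1 / 2 := by
          by_contra hne
          have : 0 < τ.re + 1 / 2 := by
            rcases lt_or_eq_of_le hx.1 with h | h
            · linarith
            · exact absurd (by linarith) hne
          nlinarith
        refine ⟨?_, Or.inr (Or.inr hxe)⟩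
        rw [hxe] at hN' hxy ⊢
        nlinarith
  · right
    have hden : denom g τ = √3 * (d * τ - c) := by simp [denom, hform]; ring
    rw [hden, Complex.normSq_mul, Complex.normSq_ofReal, hsq, Complex.normSq_apply] at hN
    simp at hN
    have hd0 : d ≠ 0 := by
      rintro rfl
      have : (3 : ℤ) ∣ 1 := ⟨-(b * c), by linarith⟩
      norm_num at this
    have hd : d ^ 2 < 5 := by
      have : (d : ℝ) ^ 2 < 5 := by
        nlinarith [mul_self_nonneg (d * τ.re - c), mul_nonneg (sq_nonneg (d : ℝ)) (sub_nonneg.2 hy)]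
      exact_mod_cast this
    obtain ⟨e, ε, he, hε, rfl⟩ : ∃ e ε : ℤ, (e = 1 ∨ e = 2) ∧ (ε = 1 ∨ ε = -1) ∧ d = ε * e := by
      have h1 : -3 < d := by nlinarith
      have h2 : d < 3 := by nlinarith
      have : d = -2 ∨ d = -1 ∨ d = 1 ∨ d = 2 := by omega
      rcases this with h | h | h | h
      · exact ⟨2, -1, by simp, by simp, by simp [h]⟩
      · exact ⟨1, -1, by simp, by simp, by simp [h]⟩
      · exact ⟨1, 1, by simp, by simp, by simp [h]⟩
      · exact ⟨2, 1, by simp, by simp, by simp [h]⟩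
    obtain ⟨s, hs⟩ : ∃ s : ℤ, s = ε * c := ⟨_, rfl⟩
    have hN' : 3 * (e * e * (τ.re * τ.re + τ.im * τ.im) - 2 * e * s * τ.re + s * s) = 1 := by
      rw [hs]; push_cast
      rcases hε with rfl | rfl <;> push_cast at hN ⊢ <;> linarith
    have hs1 : s = 0 ∧ e = 1 ∨ s = 1 ∨ s = -1 := by
      rcases he with rfl | rfl
      · have h1 : (s : ℝ) < 2 := by push_cast at hN'; nlinarith
        have h2 : (-2 : ℝ) < s := by push_cast at hN'; nlinarith
        have h1 : s < 2 := by exact_mod_cast h1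
        have h2 : -2 < s := by exact_mod_cast h2
        omega
      · have h1 : (s : ℝ) < 2 := by push_cast at hN'; nlinarith
        have h2 : (-2 : ℝ) < s := by push_cast at hN'; nlinarith
        have h1 : s < 2 := by exact_mod_cast h1
        have h2 : -2 < s := by exact_mod_cast h2
        have h3 : s ≠ 0 := by
          rintro rfl
          push_cast at hN'
          linarith
        omega
    rcases hs1 with ⟨rfl, rfl⟩ | hs1
    · have hc : c = 0 := by
        rcases hε with rfl | rfl <;> omega
      subst hc
      simp at hN'
      -- Here `|denom| = 1` only says `|τ|² = 1/3`; the real part comes from the fixed point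
      -- equation, which makes `2 re` an integer.
      refine ⟨by linarith, ?_⟩
      have him := congrArg Complex.im hQ
      simp [hform] at him
      have hb : (ε : ℝ) * (2 * τ.re) = b := by
        have : √3 * τ.im * (ε * (2 * τ.re) - b) = 0 := by linarith
        have h := (mul_eq_zero.1 this).resolve_left (mul_ne_zero h0 hy0.ne')
        linarith
      have hb' : 2 * τ.re = ((ε * b : ℤ) : ℝ) := by
        push_cast
        rw [← hb]
        rcases hε with rfl | rfl <;> push_cast <;> ring
      generalize ε * b = m at hb'
      have h1 : (m : ℝ) < 2 := by linarith
      have h2 : (-2 : ℝ) < m := by linarith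
      have h1 : m < 2 := by exact_mod_cast h1
      have h2 : -2 < m := by exact_mod_cast h2
      have : m = 0 ∨ m = 1 ∨ m = -1 := by omega
      rcases this with rfl | rfl | rfl <;> push_cast at hb'
      · left; linarith
      · right; left; linarith
      · right; right; linarith
    · rcases hs1 with rfl | rfl
      · have hxe : τ.re = 1 / 2 := by
          rcases he with rfl | rfl <;> push_cast at hN' <;> linarith
        refine ⟨?_, Or.inr (Or.inl hxe)⟩
        rw [hxe] at hN' ⊢
        rcases he with rfl | rfl <;> push_cast at hN' <;> linarith
      · have hxe : τ.re = -1 / 2 := by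
          rcases he with rfl | rfl <;> push_cast at hN' <;> linarith
        refine ⟨?_, Or.inr (Or.inr hxe)⟩
        rw [hxe] at hN' ⊢
        rcases he with rfl | rfl <;> push_cast at hN' <;> linarith

/-- A point of the fundamental domain with nontrivial stabilizer is equivalent to `i₃` or `ρ₃`. -/
theorem denom_sq_eq_one_of_mem_fundDomain {τ : ℍ} (hτ : τ ∈ fundDomain)
    (hi : ∀ g ∈ Gamma0Star 3, g • i₃ ≠ τ) (hρ : ∀ g ∈ Gamma0Star 3, g • ρ₃ ≠ τ)
    {g : GL (Fin 2) ℝ} (hg : g ∈ Gamma0Star 3) (h : g • τ = τ) : denom g τ ^ 2 = 1 := by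
  refine (denom_sq_eq_one_or hg hτ h).resolve_right ?_
  rintro ⟨hN, hx | hx | hx⟩
  · exact hi 1 (one_mem _) (by rw [one_smul]; exact ext_re_normSq (by rw [hx, re_i₃]) (by rw [hN, normSq_i₃]))
  -- The right corner of the domain is `ρ₃ + 1`.
  · obtain ⟨g, hg, hgt⟩ := exists_translation 3 1
    refine hρ g hg ?_
    rw [hgt]
    have h2 := normSq_ρ₃
    have hre := re_ρ₃
    refine ext_re_normSq ?_ ?_
    · rw [vadd_re, hx, hre]; norm_num
    · rw [vadd_re, vadd_im, hN]
      rw [hre] at h2 ⊢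
      push_cast
      linarith
  · exact hρ 1 (one_mem _) (by rw [one_smul]; exact ext_re_normSq (by rw [hx, re_ρ₃]) (by rw [hN, normSq_ρ₃]))

theorem i₃_mul_self : (i₃ : ℂ) * i₃ = -1 / 3 := by
  have h1 := normSq_i₃
  have h2 := re_i₃
  apply Complex.ext
  · rw [h2] at h1
    rw [Complex.mul_re, coe_re, coe_im, h2]
    norm_num
    linarith
  · rw [Complex.mul_im, coe_re, coe_im, h2]
    norm_num

theorem ρ₃_mul_self : (ρ₃ : ℂ) * ρ₃ = -ρ₃ - 1 / 3 := by
  have h : (√(3 : ℝ) : ℂ) * √3 = 3 := by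
    rw [← Complex.ofReal_mul, Real.mul_self_sqrt (by norm_num)]; simp
  rw [coe_ρ₃]
  push_cast
  linear_combination (Complex.I ^ 2 / 36) * h + 1 / 12 * Complex.I_mul_I

theorem W_smul_i₃ : W 3 • i₃ = i₃ := by
  apply UpperHalfPlane.ext
  rw [coe_W_smul]
  have := i₃.ne_zero
  field_simp
  linear_combination (-3) * i₃_mul_self

theorem denom_W_i₃_sq : denom (W 3) i₃ ^ 2 = -1 := by
  have h : (√(3 : ℝ) : ℂ) * √3 = 3 := by
    rw [← Complex.ofReal_mul, Real.mul_self_sqrt (by norm_num)]; simp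
  rw [denom_W]
  linear_combination (i₃ * i₃ : ℂ) * h + 3 * i₃_mul_self

/-- The fixed point equation gives `a = d` and `b = -c`, so the determinant condition reads `d² +
3c² = 1` and `c = 0`; then `denom²` is 1 on `Γ₀(3)` and -1 on the other coset. -/
theorem denom_sq_sq_of_smul_i₃ {g : GL (Fin 2) ℝ} (hg : g ∈ Gamma0Star 3) (h : g • i₃ = i₃) :
    (denom g i₃ ^ 2) ^ 2 = 1 := by
  have hC : (√(3 : ℝ) : ℂ) * √3 = 3 := by
    rw [← Complex.ofReal_mul, Real.mul_self_sqrt (by norm_num)]; simp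
  have h0 : (√(3 : ℝ)) ≠ 0 := by positivity
  have hQ := (gl_smul_eq_self_iff_quadratic (det_pos hg)).1 h
  rw [i₃_mul_self] at hQ
  have hre := congrArg Complex.re hQ
  have him := congrArg Complex.im hQ
  have hy := i₃.im_pos.ne'
  obtain ⟨a, b, c, d, hdet, hform | hform⟩ := exists_entries hg
  · simp [hform, re_i₃, hy] at hre him
    have hd : d = a := by exact_mod_cast sub_eq_zero.1 him
    have hb : b = -c := by
      have : (b : ℝ) = -c := by linarith
      exact_mod_cast this
    subst hd hb
    have hc : c = 0 := by
      by_contra hc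
      have : 0 < c * c := mul_self_pos.2 hc
      nlinarith [mul_self_nonneg d]
    subst hc
    have hden : denom g i₃ = d := by simp [denom, hform]
    rw [hden]
    have : (d : ℂ) * d = 1 := by exact_mod_cast (by linarith : d * d = 1)
    linear_combination (d * d + 1 : ℂ) * this
  · simp [hform, re_i₃, hy] at hre him
    have hb : b = -c := by
      have : √3 * (c + b : ℝ) = 0 := by linarith
      have := (mul_eq_zero.1 this).resolve_left h0
      have : (b : ℝ) = -c := by linarith
      exact_mod_cast this
    have hd : d = a := by
      have : √3 * (a - d : ℝ) = 0 := by linarith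
      have := (mul_eq_zero.1 this).resolve_left h0
      have : (d : ℝ) = a := by linarith
      exact_mod_cast this
    subst hd hb
    have hc : c = 0 := by
      by_contra hc
      have : 0 < c * c := mul_self_pos.2 hc
      nlinarith [mul_self_nonneg d]
    subst hc
    have hden : denom g i₃ = √3 * d * i₃ := by simp [denom, hform]
    have hd : (d : ℂ) * d = 1 := by exact_mod_cast (by linarith : d * d = 1)
    have : denom g i₃ ^ 2 = -1 := by
      rw [hden]
      linear_combination (d * d * i₃ * i₃ : ℂ) * hC + (3 * d * d) * i₃_mul_self - hd
    rw [this]; norm_num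

/-- The element is `T⁻¹ W`, for which `denom² = -3ρ₃ - 1` is a root of `X² - X + 1`, the sixth
cyclotomic polynomial. -/
theorem exists_primitive_denom_ρ₃ : ∃ g ∈ Gamma0Star 3, g • ρ₃ = ρ₃ ∧
    IsPrimitiveRoot (denom g ρ₃ ^ 2) 6 := by
  have hC : (√(3 : ℝ) : ℂ) * √3 = 3 := by
    rw [← Complex.ofReal_mul, Real.mul_self_sqrt (by norm_num)]; simp
  refine ⟨toReal (ModularGroup.T ^ (-1 : ℤ)) * W 3,
    mul_mem (toReal_mem_Gamma0Star (T_zpow_mem_Gamma0 3 _)) (W_mem_Gamma0Star 3), ?_, ?_⟩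
  · rw [mul_smul]
    refine (modular_T_zpow_smul _ _).trans ?_
    apply UpperHalfPlane.ext
    rw [coe_vadd, coe_W_smul]
    have := ρ₃.ne_zero
    push_cast
    field_simp
    linear_combination (-3) * ρ₃_mul_self
  · have hden : denom (toReal (ModularGroup.T ^ (-1 : ℤ)) * W 3) ρ₃ = √3 * ρ₃ := by
      have : (toReal (ModularGroup.T ^ (-1 : ℤ)) * W 3).val = !![√3 * -1, -1 / √3; √3, 0] := by
        rw [Units.val_mul, toReal_apply, W_apply, ModularGroup.coe_T_zpow, Matrix.mul_fin_two]
        simp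
      rw [denom, this]; simp
    have hv : denom (toReal (ModularGroup.T ^ (-1 : ℤ)) * W 3) ρ₃ ^ 2 = -3 * ρ₃ - 1 := by
      rw [hden]
      linear_combination (ρ₃ * ρ₃ : ℂ) * hC + 3 * ρ₃_mul_self
    have : NeZero ((6 : ℕ) : ℂ) := ⟨by norm_num⟩
    rw [hv, ← Polynomial.isRoot_cyclotomic_iff, Polynomial.cyclotomic_six]
    simp
    linear_combination 9 * ρ₃_mul_self

/-- The fixed point equation leaves two free integers, and the determinant condition becomes a
positive definite binary form equal to 1, with six solutions. For each, `denom²` is, up to sign, a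
power of the cube root of unity `3ρ₃ + 1`. -/
theorem denom_sq_pow_six_of_smul_ρ₃ {g : GL (Fin 2) ℝ} (hg : g ∈ Gamma0Star 3) (h : g • ρ₃ = ρ₃) :
    (denom g ρ₃ ^ 2) ^ 6 = 1 := by
  have hC : (√(3 : ℝ) : ℂ) * √3 = 3 := by
    rw [← Complex.ofReal_mul, Real.mul_self_sqrt (by norm_num)]; simp
  have h0 : (√(3 : ℝ)) ≠ 0 := by positivity
  have hQ := (gl_smul_eq_self_iff_quadratic (det_pos hg)).1 h
  rw [ρ₃_mul_self] at hQ
  have hre := congrArg Complex.re hQ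
  have him := congrArg Complex.im hQ
  have hy := ρ₃.im_pos
  -- both kinds of elements lead to the quadratic form `x² + 3 x y + 3 y²`
  have key : ∀ x y : ℤ, x * x + 3 * x * y + 3 * y * y = 1 →
      ((3 * y * ρ₃ + x + 3 * y : ℂ) ^ 2) ^ 6 = 1 ∧
        ((x * ρ₃ + x + y : ℂ) ^ 2 * 3) ^ 6 = 1 := by
    intro x y hxy
    have hω : (3 * ρ₃ + 1 : ℂ) ^ 2 = -(3 * ρ₃ + 1) - 1 := by
      linear_combination 9 * ρ₃_mul_self
    have hω3 : (3 * ρ₃ + 1 : ℂ) ^ 3 = 1 := by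
      linear_combination (3 * ρ₃ : ℂ) * hω
    have hω6 : (3 * ρ₃ + 1 : ℂ) ^ 6 = 1 := by
      linear_combination ((3 * ρ₃ + 1 : ℂ) ^ 3 + 1) * hω3
    have hω6' : (3 * ρ₃ + 2 : ℂ) ^ 6 = 1 := by
      have : (3 * ρ₃ + 2 : ℂ) = -(3 * ρ₃ + 1) ^ 2 := by linear_combination hω
      rw [this, neg_pow, ← pow_mul, mul_comm 2, pow_mul, hω6]
      norm_num
    have h1 : (3 * ρ₃ + 2 : ℂ) ^ 2 = 3 * ρ₃ + 1 := by linear_combination 9 * ρ₃_mul_self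
    have h2 : (3 * ρ₃ + 1 : ℂ) ^ 2 = -(3 * ρ₃ + 2) := by linear_combination hω
    have h3 : (ρ₃ : ℂ) ^ 2 * 3 = -(3 * ρ₃ + 1) := by linear_combination 3 * ρ₃_mul_self
    have h4 : (ρ₃ + 1 : ℂ) ^ 2 * 3 = 3 * ρ₃ + 2 := by linear_combination 3 * ρ₃_mul_self
    have h5 : (2 * ρ₃ + 1 : ℂ) ^ 2 * 3 = -1 := by linear_combination 12 * ρ₃_mul_self
    -- Four times the form is `(2x + 3y)² + 3y²`.
    have hy2 : y * y < 2 := by nlinarith [mul_self_nonneg (2 * x + 3 * y)]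
    have hy3 : y = 0 ∨ y = 1 ∨ y = -1 := by
      have : y < 2 := by nlinarith
      have : -2 < y := by nlinarith
      omega
    have hcases : (y = 0 ∧ (x = 1 ∨ x = -1)) ∨ (y = 1 ∧ (x = -1 ∨ x = -2)) ∨
        (y = -1 ∧ (x = 1 ∨ x = 2)) := by
      rcases hy3 with rfl | rfl | rfl
      · have : (x - 1) * (x + 1) = 0 := by linarith
        rcases mul_eq_zero.1 this with h | h <;> omega
      · have : (x + 1) * (x + 2) = 0 := by linarith
        rcases mul_eq_zero.1 this with h | h <;> omega
      · have : (x - 1) * (x - 2) = 0 := by linarith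
        rcases mul_eq_zero.1 this with h | h <;> omega
    rcases hcases with ⟨rfl, rfl | rfl⟩ | ⟨rfl, rfl | rfl⟩ | ⟨rfl, rfl | rfl⟩ <;> push_cast <;>
      refine ⟨?_, ?_⟩
    · norm_num
    · rw [show (1 * ρ₃ + 1 + 0 : ℂ) = ρ₃ + 1 by ring, h4, hω6']
    · norm_num
    · rw [show (-1 * ρ₃ + -1 + 0 : ℂ) = -(ρ₃ + 1) by ring, neg_sq, h4, hω6']
    · rw [show (3 * 1 * ρ₃ + -1 + 3 * 1 : ℂ) = 3 * ρ₃ + 2 by ring, h1, hω6]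
    · rw [show (-1 * ρ₃ + -1 + 1 : ℂ) = -ρ₃ by ring, neg_sq, h3, neg_pow, hω6]; norm_num
    · rw [show (3 * 1 * ρ₃ + -2 + 3 * 1 : ℂ) = 3 * ρ₃ + 1 by ring, h2, neg_pow, hω6']; norm_num
    · rw [show (-2 * ρ₃ + -2 + 1 : ℂ) = -(2 * ρ₃ + 1) by ring, neg_sq, h5]; norm_num
    · rw [show (3 * -1 * ρ₃ + 1 + 3 * -1 : ℂ) = -(3 * ρ₃ + 2) by ring, neg_sq, h1, hω6]
    · rw [show (1 * ρ₃ + 1 + -1 : ℂ) = ρ₃ by ring, h3, neg_pow, hω6]; norm_num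
    · rw [show (3 * -1 * ρ₃ + 2 + 3 * -1 : ℂ) = -(3 * ρ₃ + 1) by ring, neg_sq, h2, neg_pow, hω6']
      norm_num
    · rw [show (2 * ρ₃ + 2 + -1 : ℂ) = 2 * ρ₃ + 1 by ring, h5]; norm_num
  obtain ⟨a, b, c, d, hdet, hform | hform⟩ := exists_entries hg
  · simp [hform] at hre him
    have hd : d = a + 3 * c := by
      have : ρ₃.im * (d - a - 3 * c) = 0 := by linarith
      have := (mul_eq_zero.1 this).resolve_left hy.ne'
      have : (d : ℝ) = a + 3 * c := by linarith
      exact_mod_cast this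
    have hb : b = -c := by
      rw [hd] at hre; push_cast at hre
      have : (b : ℝ) = -c := by linarith
      exact_mod_cast this
    subst hd hb
    have hden : denom g ρ₃ = 3 * c * ρ₃ + a + 3 * c := by simp [denom, hform]; ring
    rw [hden]
    exact (key a c (by linarith)).1
  · simp [hform] at hre him
    have hc : c = -(b + d) := by
      have : √3 * ρ₃.im * (c + b + d) = 0 := by linarith
      have := (mul_eq_zero.1 this).resolve_left (mul_ne_zero h0 hy.ne')
      have : (c : ℝ) = -(b + d) := by linarith
      exact_mod_cast this
    have ha : a = d := by
      rw [hc] at hre; push_cast at hre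
      have : √3 * (a - d) = 0 := by linarith
      have := (mul_eq_zero.1 this).resolve_left h0
      have : (a : ℝ) = d := by linarith
      exact_mod_cast this
    subst hc ha
    have hden : denom g ρ₃ ^ 2 = (a * ρ₃ + a + b) ^ 2 * 3 := by
      simp [denom, hform]
      linear_combination (a * ρ₃ + a + b : ℂ) ^ 2 * hC
    rw [hden]
    exact (key a b (by linarith)).2

end Fricke

/-! ### Roots of analytic functions and maps commuting with them up to roots of unity -/

theorem AnalyticAt.exists_eq_pow {h : ℂ → ℂ} {z₀ : ℂ} {n : ℕ} (hn : n ≠ 0) (hh : AnalyticAt ℂ h z₀)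
    (hord : analyticOrderAt h z₀ = n) : ∃ w : ℂ → ℂ, AnalyticAt ℂ w z₀ ∧ w z₀ = 0 ∧
      deriv w z₀ ≠ 0 ∧ ∀ᶠ z in 𝓝 z₀, h z = w z ^ n := by
  obtain ⟨g, hg, hg0, hgh⟩ := hh.analyticOrderAt_eq_natCast.1 hord
  obtain ⟨c, hc⟩ := IsAlgClosed.exists_pow_nat_eq (g z₀) (Nat.pos_of_ne_zero hn)
  have hc0 : c ≠ 0 := by
    rintro rfl
    exact hg0 (by rw [← hc, zero_pow hn])
  -- Dividing by `g z₀` puts the base of the power near 1, where the principal branch is analytic;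
  -- `c` restores the constant.
  have hv : AnalyticAt ℂ (fun z ↦ c * (g z / g z₀) ^ ((n : ℂ)⁻¹)) z₀ := by
    refine analyticAt_const.mul ((hg.div_const).cpow analyticAt_const ?_)
    rw [div_self hg0]
    exact Complex.one_mem_slitPlane
  have hv0 : c * (g z₀ / g z₀) ^ ((n : ℂ)⁻¹) = c := by rw [div_self hg0, Complex.one_cpow, mul_one]
  refine ⟨fun z ↦ (z - z₀) * (c * (g z / g z₀) ^ ((n : ℂ)⁻¹)), by fun_prop, by simp, ?_, ?_⟩
  · have h1 : HasDerivAt (fun z ↦ z - z₀) 1 z₀ := (hasDerivAt_id z₀).sub_const z₀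
    have h2 : deriv (fun z ↦ (z - z₀) * (c * (g z / g z₀) ^ ((n : ℂ)⁻¹))) z₀ = _ :=
      (h1.mul hv.differentiableAt.hasDerivAt).deriv
    rw [h2, hv0, sub_self, zero_mul, add_zero, one_mul]
    exact hc0
  · filter_upwards [hgh] with z hz
    rw [hz, mul_pow, mul_pow, Complex.cpow_nat_inv_pow _ hn, hc, smul_eq_mul, mul_div_cancel₀ _ hg0]

theorem Filter.Tendsto.eventually_eq_of_finite {α X : Type*} [TopologicalSpace X] [T1Space X]
    {l : Filter α} {f : α → X} {a : X} (h : Tendsto f l (𝓝 a)) {S : Set X} (hS : S.Finite)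
    (hfS : ∀ᶠ x in l, f x ∈ S) : ∀ᶠ x in l, f x = a := by
  have : (S \ {a})ᶜ ∈ 𝓝 a := (hS.subset Set.sdiff_subset).isClosed.isOpen_compl.mem_nhds (by simp)
  filter_upwards [h this, hfS] with x h1 h2
  by_contra h3
  exact h1 ⟨h2, h3⟩

/-- If `w` is a local coordinate, `G` a map fixing its centre and `w ∘ G` differs from `w` by
`n`-th roots of unity, then `w ∘ G` is a multiple of `w`. -/
theorem eventually_comp_eq_deriv_mul {w G : ℂ → ℂ} {z₀ : ℂ} {n : ℕ} (hn : n ≠ 0)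
    (hw : AnalyticAt ℂ w z₀) (hw0 : w z₀ = 0) (hw' : deriv w z₀ ≠ 0) (hG : AnalyticAt ℂ G z₀)
    (hG0 : G z₀ = z₀) (h : ∀ᶠ z in 𝓝 z₀, w (G z) ^ n = w z ^ n) :
    ∀ᶠ z in 𝓝 z₀, w (G z) = deriv G z₀ * w z := by
  have h1 : HasDerivAt w (deriv w z₀) z₀ := hw.differentiableAt.hasDerivAt
  have h2 : HasDerivAt (w ∘ G) (deriv w z₀ * deriv G z₀) z₀ :=
    HasDerivAt.comp z₀ (by rwa [hG0]) hG.differentiableAt.hasDerivAt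
  have h3 := (hasDerivAt_iff_tendsto_slope.1 h2).div (hasDerivAt_iff_tendsto_slope.1 h1) hw'
  rw [mul_div_cancel_left₀ _ hw'] at h3
  have hne : ∀ᶠ z in 𝓝[≠] z₀, w z ≠ 0 := by
    simpa [hw0] using h1.eventually_ne (c := 0) hw'
  have h4 : ∀ᶠ z in 𝓝[≠] z₀, (slope (w ∘ G) z₀ / slope w z₀) z = w (G z) / w z := by
    filter_upwards [self_mem_nhdsWithin] with z hz
    have : z - z₀ ≠ 0 := sub_ne_zero.2 hz
    simp only [Pi.div_apply, slope_def_field, Function.comp_apply, hG0, hw0, sub_zero]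
    field_simp
  -- The quotient `w (G z) / w z` tends to `deriv G z₀` and takes values in the finite set of `n`-th
  -- roots of unity, so it is eventually constant.
  have h5 := (h3.congr' h4).eventually_eq_of_finite
    (S := {ζ : ℂ | ζ ^ n = 1}) (by
      refine (Polynomial.nthRootsFinset n (1 : ℂ)).finite_toSet.subset fun ζ hζ ↦ ?_
      simpa [Polynomial.mem_nthRootsFinset (Nat.pos_of_ne_zero hn)] using hζ) (by
      filter_upwards [nhdsWithin_le_nhds h, hne] with z hz hz0
      rw [div_pow, hz, div_self (pow_ne_zero n hz0)])
  rw [eventually_nhdsWithin_iff] at h5 hne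
  filter_upwards [h5, hne] with z hz hz0
  by_cases hzz : z = z₀
  · rw [hzz, hG0, hw0, mul_zero]
  · rw [← hz hzz, div_mul_cancel₀ _ (hz0 hzz)]

/-! ### Invariant functions near a point -/

namespace Fricke

theorem eventually_nhds_coe_iff {P : ℍ} {p : ℂ → Prop} :
    (∀ᶠ z in 𝓝 (P : ℂ), p z) ↔ ∀ᶠ τ : ℍ in 𝓝 P, p τ := by
  rw [← isOpenEmbedding_coe.map_nhds_eq, eventually_map]

/-- `t` is invariant under `Γ₀*(3)`. -/
def Invariant (t : ℍ → ℂ) : Prop := ∀ g ∈ Gamma0Star 3, ∀ τ : ℍ, t (g • τ) = t τ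

/-- `t` is holomorphic on the upper half-plane. -/
def Holomorphic (t : ℍ → ℂ) : Prop := ∀ τ : ℍ, AnalyticAt ℂ (fun z ↦ t (ofComplex z)) τ

theorem Holomorphic.continuous {t : ℍ → ℂ} (h : Holomorphic t) : Continuous t := by
  rw [continuous_iff_continuousAt]
  intro τ
  have := (h τ).continuousAt.comp (f := ((↑) : ℍ → ℂ)) continuous_coe.continuousAt
  simpa [Function.comp_def] using this

/-- A local coordinate at `P` in which an invariant function is a power and the stabilizer acts by
multiplication. -/
theorem exists_local_coordinate {t : ℍ → ℂ} (hinv : Invariant t) (hol : Holomorphic t) {P : ℍ}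
    {n : ℕ} (hn : n ≠ 0)
    (hord : analyticOrderAt (fun z ↦ t (ofComplex z) - t P) P = n) :
    ∃ W : ℍ → ℂ, map W (𝓝 P) = 𝓝 0 ∧ (∃ U ∈ 𝓝 P, Set.InjOn W U) ∧
      (∀ᶠ τ in 𝓝 P, t τ = t P + W τ ^ n) ∧
      ∀ g ∈ Gamma0Star 3, g • P = P → ∀ᶠ τ in 𝓝 P, W (g • τ) = (denom g P ^ 2)⁻¹ * W τ := by
  obtain ⟨w, hw, hw0, hw', hwt⟩ := AnalyticAt.exists_eq_pow hn ((hol P).sub analyticAt_const) hord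
  simp only [Pi.sub_apply] at hwt
  have hs : HasStrictDerivAt w (deriv w P) P := hw.hasStrictDerivAt
  refine ⟨fun τ ↦ w τ, ?_, ?_, ?_, ?_⟩
  · have := hs.map_nhds_eq hw'
    rw [hw0, ← isOpenEmbedding_coe.map_nhds_eq, map_map] at this
    exact this
  · have hl : ∀ᶠ τ : ℍ in 𝓝 P, hs.localInverse _ _ _ hw' (w τ) = τ :=
      eventually_nhds_coe_iff.1 (hs.eventually_left_inverse hw')
    refine ⟨_, hl, fun x hx y hy hxy ↦ UpperHalfPlane.ext ?_⟩
    rw [← hx, ← hy]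
    exact congrArg _ hxy
  · filter_upwards [eventually_nhds_coe_iff.1 hwt] with τ hτ
    rw [← hτ, ofComplex_apply]; ring
  · intro g hg hgP
    -- As `det g = 1`, the derivative of `g` at its fixed point is `denom⁻²`.
    have hd := deriv_smul (det_pos hg) P
    rw [det_eq_one hg] at hd
    have hG0 : ((g • ofComplex (P : ℂ) : ℍ) : ℂ) = P := by rw [ofComplex_apply, hgP]
    have hGc : Tendsto (fun z : ℂ ↦ ((g • ofComplex z : ℍ) : ℂ)) (𝓝 (P : ℂ)) (𝓝 (P : ℂ)) := by
      have := (analyticAt_smul (det_pos hg) P).continuousAt.tendsto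
      rwa [hG0] at this
    have key := eventually_comp_eq_deriv_mul hn hw hw0 hw' (analyticAt_smul (det_pos hg) P) hG0 (by
      filter_upwards [hwt, hGc.eventually hwt] with z hz hz'
      rw [← hz, ← hz', ofComplex_apply, hinv g hg])
    filter_upwards [eventually_nhds_coe_iff.1 key] with τ hτ
    rw [ofComplex_apply, hd] at hτ
    rw [hτ, Complex.ofReal_one, one_div]

theorem orbit_eq_iff {p : ℕ} [Fact p.Prime] {P Q : ℍ} :
    orbit p P = orbit p Q ↔ ∃ g ∈ Gamma0Star p, g • Q = P := by
  rw [orbit, orbit, Quotient.eq (r := MulAction.orbitRel (Gamma0Star p) ℍ), MulAction.orbitRel_apply]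
  exact ⟨fun ⟨g, hg⟩ ↦ ⟨g, g.2, hg⟩, fun ⟨g, hg, h⟩ ↦ ⟨⟨g, hg⟩, h⟩⟩

theorem orbit_smul {p : ℕ} [Fact p.Prime] {g : GL (Fin 2) ℝ} (hg : g ∈ Gamma0Star p) (P : ℍ) :
    orbit p (g • P) = orbit p P := orbit_eq_iff.2 ⟨g, hg, rfl⟩

/-- `c` is taken by `t` in two different orbits. -/
def Repeated (t : ℍ → ℂ) (c : ℂ) : Prop :=
  ∃ P Q : ℍ, t P = c ∧ t Q = c ∧ orbit 3 P ≠ orbit 3 Q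

theorem finite_stabilizer (P : ℍ) : {g : Gamma0Star 3 | (g : GL (Fin 2) ℝ) • P = P}.Finite :=
  ProperlyDiscontinuousSMul.finite_stabilizer' (Gamma0Star 3) P

/-- Take a value near `t P`, different from it and taken in one orbit only. The points with
coordinates `ε` and `ζ ε` both take it, so some `g` maps one to the other; by proper discontinuity
`g` fixes `P`, and it acts on the coordinate by its multiplier, which must be `ζ`. -/
theorem exists_smul_of_pow_eq_one {t : ℍ → ℂ} {P : ℍ} {n : ℕ} {W : ℍ → ℂ}
    (hn : n ≠ 0) (hmap : map W (𝓝 P) = 𝓝 0) (htW : ∀ᶠ τ in 𝓝 P, t τ = t P + W τ ^ n)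
    (hWg : ∀ g ∈ Gamma0Star 3, g • P = P → ∀ᶠ τ in 𝓝 P, W (g • τ) = (denom g P ^ 2)⁻¹ * W τ)
    (hfreq : ∃ᶠ c in 𝓝[≠] (t P), ¬ Repeated t c) (ζ : ℂ) (hζ : ζ ^ n = 1) :
    ∃ g ∈ Gamma0Star 3, g • P = P ∧ ζ = (denom g P ^ 2)⁻¹ := by
  obtain ⟨U, hU, hUg⟩ := ProperlyDiscontinuousSMul.exists_nhds_image_smul_eq_self (Gamma0Star 3) P
  have hall : ∀ᶠ τ in 𝓝 P, ∀ g ∈ {g : Gamma0Star 3 | (g : GL (Fin 2) ℝ) • P = P},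
      W ((g : GL (Fin 2) ℝ) • τ) = (denom (g : GL (Fin 2) ℝ) P ^ 2)⁻¹ * W τ :=
    (eventually_all_finite (finite_stabilizer P)).2 fun g hg ↦ hWg g g.2 hg
  have himg : W '' (U ∩ {τ | t τ = t P + W τ ^ n ∧
      ∀ g ∈ {g : Gamma0Star 3 | (g : GL (Fin 2) ℝ) • P = P},
        W ((g : GL (Fin 2) ℝ) • τ) = (denom (g : GL (Fin 2) ℝ) P ^ 2)⁻¹ * W τ}) ∈ 𝓝 (0 : ℂ) := by
    rw [← hmap]
    exact image_mem_map (inter_mem hU (htW.and hall))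
  obtain ⟨r, hr, hball⟩ := Metric.mem_nhds_iff.1 himg
  have hev : ∀ᶠ c in 𝓝[≠] (t P), ‖c - t P‖ < r ^ n ∧ c ≠ t P := by
    refine Filter.Eventually.and (nhdsWithin_le_nhds ?_) self_mem_nhdsWithin
    have := Metric.ball_mem_nhds (t P) (pow_pos hr n)
    filter_upwards [this] with c hc
    rwa [mem_ball_iff_norm] at hc
  obtain ⟨c, hc, hcr, hcne⟩ := (hfreq.and_eventually hev).exists
  obtain ⟨ε, hε⟩ := IsAlgClosed.exists_pow_nat_eq (c - t P) (Nat.pos_of_ne_zero hn)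
  have hε0 : ε ≠ 0 := by
    rintro rfl
    rw [zero_pow hn] at hε
    exact hcne (sub_eq_zero.1 hε.symm)
  have hεr : ‖ε‖ < r := by
    rw [← hε, norm_pow] at hcr
    exact lt_of_pow_lt_pow_left₀ n hr.le hcr
  have hζ1 : ‖ζ‖ = 1 := Complex.norm_eq_one_of_pow_eq_one hζ hn
  obtain ⟨z, ⟨hzU, hz, hzg⟩, hzε⟩ := hball (mem_ball_zero_iff.2 hεr)
  obtain ⟨z', ⟨hzU', hz', -⟩, hzε'⟩ := hball (a := ζ * ε)
    (mem_ball_zero_iff.2 (by rw [norm_mul, hζ1, one_mul]; exact hεr))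
  have h1 : t z = c := by rw [hz, hzε, hε]; ring
  have h2 : t z' = c := by rw [hz', hzε', mul_pow, hζ, hε]; ring
  have horb : orbit 3 z' = orbit 3 z := by
    by_contra hne
    exact hc ⟨z', z, h2, h1, hne⟩
  obtain ⟨g, hg, hgz⟩ := orbit_eq_iff.1 horb
  have hgP : g • P = P := hUg ⟨g, hg⟩ ⟨z', ⟨z, hzU, hgz⟩, hzU'⟩
  refine ⟨g, hg, hgP, ?_⟩
  have := hzg ⟨g, hg⟩ hgP
  simp only at this
  rw [hgz, hzε', hzε] at this
  exact mul_right_cancel₀ hε0 this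

/-- Equal values mean that the coordinates differ by an `n`-th root of unity, which an element of
the stabilizer realizes. -/
theorem eventually_orbit_eq {t : ℍ → ℂ} {P : ℍ} {n : ℕ} {W : ℍ → ℂ} (hn : n ≠ 0)
    (hinj : ∃ U ∈ 𝓝 P, Set.InjOn W U)
    (htW : ∀ᶠ τ in 𝓝 P, t τ = t P + W τ ^ n)
    (hWg : ∀ g ∈ Gamma0Star 3, g • P = P → ∀ᶠ τ in 𝓝 P, W (g • τ) = (denom g P ^ 2)⁻¹ * W τ)
    (hroot : ∀ ζ : ℂ, ζ ^ n = 1 → ∃ g ∈ Gamma0Star 3, g • P = P ∧ ζ = (denom g P ^ 2)⁻¹) :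
    ∃ U ∈ 𝓝 P, ∀ z ∈ U, ∀ z' ∈ U, t z = t z' → orbit 3 z = orbit 3 z' := by
  obtain ⟨V, hV, hVinj⟩ := hinj
  have hall : ∀ᶠ τ in 𝓝 P, ∀ g ∈ {g : Gamma0Star 3 | (g : GL (Fin 2) ℝ) • P = P},
      W ((g : GL (Fin 2) ℝ) • τ) = (denom (g : GL (Fin 2) ℝ) P ^ 2)⁻¹ * W τ ∧
        (g : GL (Fin 2) ℝ) • τ ∈ V := by
    refine (eventually_all_finite (finite_stabilizer P)).2 fun g hg ↦ (hWg g g.2 hg).and ?_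
    have hg : (g : GL (Fin 2) ℝ) • P = P := hg
    have := (continuous_const_smul (g : GL (Fin 2) ℝ)).tendsto P
    rw [hg] at this
    exact this hV
  refine ⟨V ∩ _, inter_mem hV (htW.and hall), ?_⟩
  rintro z ⟨hzV, hz, hzg⟩ z' ⟨hzV', hz', -⟩ hzz
  have hpow : W z' ^ n = W z ^ n := by
    rw [hz, hz'] at hzz
    exact (add_left_cancel hzz).symm
  by_cases h0 : W z = 0
  · have h0' : W z' = 0 := by
      rw [h0, zero_pow hn] at hpow
      exact eq_zero_of_pow_eq_zero hpow
    rw [hVinj hzV hzV' (h0.trans h0'.symm)]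
  · obtain ⟨g, hg, hgP, hζ⟩ := hroot (W z' / W z) (by
      rw [div_pow, hpow, div_self (pow_ne_zero n h0)])
    obtain ⟨h1, h2⟩ := hzg ⟨g, hg⟩ hgP
    simp only at h1 h2
    rw [← hζ, div_mul_cancel₀ _ h0] at h1
    rw [← hVinj h2 hzV' h1, orbit_smul hg]

/-! ### A Hauptmodul separates orbits -/

/-- An invariant holomorphic function with a simple pole at the cusp. -/
structure IsHauptmodul (t : ℍ → ℂ) : Prop where
  invariant : Invariant t
  holomorphic : Holomorphic t
  tendsto_norm : Tendsto (fun τ ↦ ‖t τ‖) atImInfty atTop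
  injective_near_cusp : ∃ Y : ℝ, ∀ τ τ' : ℍ, Y < τ.im → Y < τ'.im → t τ = t τ' →
    orbit 3 τ = orbit 3 τ'

variable {t : ℍ → ℂ}

theorem exists_mem_fundDomain_orbit (P : ℍ) : ∃ Q ∈ fundDomain, orbit 3 Q = orbit 3 P := by
  obtain ⟨g, hg, h⟩ := exists_smul_mem_fundDomain P
  exact ⟨_, h, orbit_smul hg P⟩

theorem Invariant.eq_of_orbit_eq (h : Invariant t) {P Q : ℍ} (hPQ : orbit 3 P = orbit 3 Q) :
    t P = t Q := by
  obtain ⟨g, hg, rfl⟩ := orbit_eq_iff.1 hPQ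
  exact h g hg Q

namespace IsHauptmodul

theorem exists_lt_norm (ht : IsHauptmodul t) (M : ℝ) : ∃ Y : ℝ, ∀ τ : ℍ, Y ≤ τ.im → M < ‖t τ‖ := by
  obtain ⟨Y, hY⟩ := (atImInfty_mem _).1 (ht.tendsto_norm.eventually_gt_atTop M)
  exact ⟨Y, hY⟩

/-- Above height `Y` equal values lie in one orbit, so a repeated value is also taken on the compact
part of the fundamental domain. -/
theorem exists_forall_repeated_norm_le (ht : IsHauptmodul t) :
    ∃ M : ℝ, ∀ c, Repeated t c → ‖c‖ ≤ M := by
  obtain ⟨Y, hY⟩ := ht.injective_near_cusp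
  obtain ⟨M, hM⟩ := (isCompact_fundDomain_le Y).exists_bound_of_continuousOn
    ht.holomorphic.continuous.continuousOn
  refine ⟨M, ?_⟩
  rintro c ⟨P, Q, hP, hQ, hPQ⟩
  by_contra! hc
  obtain ⟨P', hPf, hP'⟩ := exists_mem_fundDomain_orbit P
  obtain ⟨Q', hQf, hQ'⟩ := exists_mem_fundDomain_orbit Q
  rw [← ht.invariant.eq_of_orbit_eq hP'] at hP
  rw [← ht.invariant.eq_of_orbit_eq hQ'] at hQ
  rw [← hP', ← hQ'] at hPQ
  refine hPQ (hY P' Q' ?_ ?_ (hP.trans hQ.symm))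
  · by_contra! h
    exact absurd (hM P' ⟨hPf, h⟩) (by rw [hP]; exact hc.not_ge)
  · by_contra! h
    exact absurd (hM Q' ⟨hQf, h⟩) (by rw [hQ]; exact hc.not_ge)

/-- By the identity theorem `t` would be constant, but it is unbounded at the cusp. -/
theorem analyticOrderAt_ne_top (ht : IsHauptmodul t) (P : ℍ) :
    analyticOrderAt (fun z ↦ t (ofComplex z) - t P) P ≠ ⊤ := by
  intro h
  rw [analyticOrderAt_eq_top] at h
  have han : AnalyticOnNhd ℂ (fun z ↦ t (ofComplex z) - t P) upperHalfPlaneSet := fun z hz ↦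
    (ht.holomorphic ⟨z, hz⟩).sub analyticAt_const
  have hpre : IsPreconnected upperHalfPlaneSet := (convex_halfSpace_im_gt 0).isPreconnected
  have := han.eqOn_zero_of_preconnected_of_eventuallyEq_zero hpre P.im_pos h
  obtain ⟨Y, hY⟩ := ht.exists_lt_norm ‖t P‖
  set τ : ℍ := ⟨Complex.I * (max Y 1 : ℝ), by simp⟩ with hτ
  have h1 := hY τ (by simp [hτ, ← coe_im])
  have h2 := this τ.im_pos
  simp [sub_eq_zero] at h2
  rw [h2] at h1
  exact lt_irrefl _ h1

theorem exists_order (ht : IsHauptmodul t) (P : ℍ) : ∃ n : ℕ, n ≠ 0 ∧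
    analyticOrderAt (fun z ↦ t (ofComplex z) - t P) P = n := by
  obtain ⟨n, hn⟩ := ENat.ne_top_iff_exists.1 (ht.analyticOrderAt_ne_top P)
  refine ⟨n, ?_, hn.symm⟩
  rintro rfl
  exact analyticOrderAt_ne_zero.2 ⟨(ht.holomorphic P).sub analyticAt_const, by simp⟩ hn.symm

theorem nhds_le_map (ht : IsHauptmodul t) (P : ℍ) : 𝓝 (t P) ≤ map t (𝓝 P) := by
  rcases (ht.holomorphic P).eventually_constant_or_nhds_le_map_nhds with h | h
  · refine absurd ?_ (ht.analyticOrderAt_ne_top P)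
    rw [analyticOrderAt_eq_top]
    filter_upwards [h] with z hz
    rw [hz]; simp
  · rw [ofComplex_apply, ← isOpenEmbedding_coe.map_nhds_eq, map_map] at h
    simpa [Function.comp_def] using h

/-- Choose representatives `P_n`, `Q_n` of repeated values tending to `c`; by compactness they
converge to some `P`, `Q` along a subsequence. If the orbits of `P` and `Q` differ, the open mapping
theorem and the Hausdorff quotient make all nearby values repeated. If they agree, move `Q` to `P`:
were there unrepeated values arbitrarily near `c`, then `t` would separate orbits near `P`, contrary
to the choice of `P_n` and `Q_n`. -/
theorem eventually_repeated (ht : IsHauptmodul t) {c : ℂ} (hc : c ∈ closure {c | Repeated t c}) :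
    ∀ᶠ c' in 𝓝[≠] c, Repeated t c' := by
  obtain ⟨u, hu, huc⟩ := mem_closure_iff_seq_limit.1 hc
  have hred : ∀ n, ∃ p : ℍ × ℍ, p.1 ∈ fundDomain ∧ p.2 ∈ fundDomain ∧ t p.1 = u n ∧ t p.2 = u n ∧
      orbit 3 p.1 ≠ orbit 3 p.2 := by
    intro n
    obtain ⟨P, Q, hP, hQ, hPQ⟩ := hu n
    obtain ⟨P', hPf, hP'⟩ := exists_mem_fundDomain_orbit P
    obtain ⟨Q', hQf, hQ'⟩ := exists_mem_fundDomain_orbit Q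
    exact ⟨(P', Q'), hPf, hQf, (ht.invariant.eq_of_orbit_eq hP').trans hP,
      (ht.invariant.eq_of_orbit_eq hQ').trans hQ, by simpa only [hP', hQ'] using hPQ⟩
  choose p hp1 hp2 hpt1 hpt2 hpne using hred
  obtain ⟨M, hM⟩ := ht.exists_forall_repeated_norm_le
  obtain ⟨Y, hY⟩ := ht.exists_lt_norm M
  have hle : ∀ (n : ℕ) (τ : ℍ), t τ = u n → τ.im ≤ Y := by
    intro n τ hτ
    by_contra! h
    have := hY τ h.le
    rw [hτ] at this
    exact absurd (hM _ (hu n)) this.not_ge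
  have hK := isCompact_fundDomain_le Y
  obtain ⟨⟨P, Q⟩, -, φ, hφ, hlim⟩ := (hK.prod hK).tendsto_subseq
    (x := p) (fun n ↦ ⟨⟨hp1 n, hle n _ (hpt1 n)⟩, ⟨hp2 n, hle n _ (hpt2 n)⟩⟩)
  have hlimP : Tendsto (fun n ↦ (p (φ n)).1) atTop (𝓝 P) := (continuous_fst.tendsto _).comp hlim
  have hlimQ : Tendsto (fun n ↦ (p (φ n)).2) atTop (𝓝 Q) := (continuous_snd.tendsto _).comp hlim
  have huφ := huc.comp hφ.tendsto_atTop
  have htc := ht.holomorphic.continuous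
  have htP : t P = c := tendsto_nhds_unique ((htc.tendsto P).comp hlimP) (by
    simpa only [Function.comp_def, hpt1] using huφ)
  have htQ : t Q = c := tendsto_nhds_unique ((htc.tendsto Q).comp hlimQ) (by
    simpa only [Function.comp_def, hpt2] using huφ)
  by_cases hPQ : orbit 3 P = orbit 3 Q
  · obtain ⟨g, hg, hgQ⟩ := orbit_eq_iff.1 hPQ
    obtain ⟨n, hn, hord⟩ := ht.exists_order P
    obtain ⟨W, hmap, hinj, htW, hWg⟩ := exists_local_coordinate ht.invariant ht.holomorphic hn hord
    by_contra hfreq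
    have hroot := exists_smul_of_pow_eq_one hn hmap htW hWg (by rw [htP]; exact not_eventually.1 hfreq)
    obtain ⟨U, hU, hUt⟩ := eventually_orbit_eq hn hinj htW hWg hroot
    have hlimQ' : Tendsto (fun n ↦ g • (p (φ n)).2) atTop (𝓝 P) := by
      rw [← hgQ]
      exact ((continuous_const_smul g).tendsto Q).comp hlimQ
    obtain ⟨m, hm1, hm2⟩ := ((hlimP.eventually hU).and (hlimQ'.eventually hU)).exists
    have := hUt _ hm1 _ hm2 (by rw [ht.invariant g hg, hpt1, hpt2])
    rw [orbit_smul hg] at this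
    exact hpne _ this
  · have hq : Continuous (orbit 3) := continuous_quot_mk
    obtain ⟨A, B, hA, hB, hPA, hQB, hAB⟩ := t2_separation hPQ
    have hA' := ht.nhds_le_map P (image_mem_map ((hA.preimage hq).mem_nhds hPA))
    have hB' := ht.nhds_le_map Q (image_mem_map ((hB.preimage hq).mem_nhds hQB))
    rw [htP] at hA'
    rw [htQ] at hB'
    refine nhdsWithin_le_nhds ?_
    filter_upwards [hA', hB'] with c' ⟨P', hP', hPc⟩ ⟨Q', hQ', hQc⟩
    refine ⟨P', Q', hPc, hQc, fun h ↦ ?_⟩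
    exact Set.disjoint_left.1 hAB hP' (h ▸ hQ')

/-- The closure of the set of repeated values is open and closed in the connected space `ℂ`, and
bounded, hence empty. -/
theorem not_repeated (ht : IsHauptmodul t) (c : ℂ) : ¬ Repeated t c := by
  have hopen : IsOpen (closure {c | Repeated t c}) := by
    rw [isOpen_iff_mem_nhds]
    intro c hc
    have := eventually_nhdsWithin_iff.1 (ht.eventually_repeated hc)
    filter_upwards [this] with c' hc'
    by_cases h : c' = c
    · rwa [h]
    · exact subset_closure (hc' h)
  obtain ⟨M, hM⟩ := ht.exists_forall_repeated_norm_le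
  have hbdd : closure {c | Repeated t c} ⊆ Metric.closedBall 0 M :=
    closure_minimal (fun c hc ↦ mem_closedBall_zero_iff.2 (hM c hc)) Metric.isClosed_closedBall
  rcases isClopen_iff.1 ⟨isClosed_closure, hopen⟩ with h | h
  · intro hc
    have : c ∈ closure {c | Repeated t c} := subset_closure hc
    rw [h] at this
    exact this
  · have h1 : ((|M| + 1 : ℝ) : ℂ) ∈ Metric.closedBall (0 : ℂ) M := hbdd (by rw [h]; trivial)
    rw [mem_closedBall_zero_iff, Complex.norm_real, Real.norm_of_nonneg (by positivity)] at h1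
    linarith [le_abs_self M]

theorem orbit_eq_of_eq (ht : IsHauptmodul t) {P Q : ℍ} (h : t P = t Q) : orbit 3 P = orbit 3 Q := by
  by_contra hne
  exact ht.not_repeated (t Q) ⟨P, Q, h, rfl, hne⟩

/-- The order of `t - t P` at `P` is the order of the group of multipliers of the stabilizer. -/
theorem exists_order_iff (ht : IsHauptmodul t) (P : ℍ) : ∃ n : ℕ, n ≠ 0 ∧
    analyticOrderAt (fun z ↦ t (ofComplex z) - t P) P = n ∧
    ∀ ζ : ℂ, ζ ^ n = 1 ↔ ∃ g ∈ Gamma0Star 3, g • P = P ∧ ζ = (denom g P ^ 2)⁻¹ := by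
  obtain ⟨n, hn, hord⟩ := ht.exists_order P
  refine ⟨n, hn, hord, fun ζ ↦ ⟨?_, ?_⟩⟩
  · obtain ⟨W, hmap, hinj, htW, hWg⟩ := exists_local_coordinate ht.invariant ht.holomorphic hn hord
    exact exists_smul_of_pow_eq_one hn hmap htW hWg
      (Eventually.of_forall ht.not_repeated).frequently ζ
  · rintro ⟨g, hg, hgP, rfl⟩
    obtain ⟨W, hmap, hinj, htW, hWg⟩ := exists_local_coordinate ht.invariant ht.holomorphic hn hord
    have hcont : Tendsto (g • · : ℍ → ℍ) (𝓝 P) (𝓝 P) := by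
      have := (continuous_const_smul g).tendsto P
      rwa [hgP] at this
    -- A nearby point with nonzero coordinate is needed to cancel `W τ ^ n` in the comparison of `t
    -- (g • τ)` with `t τ`.
    have hne : ∃ᶠ τ in 𝓝 P, W τ ≠ 0 := by
      have : ∃ᶠ z in 𝓝 (0 : ℂ), z ≠ 0 := by
        have : ∃ᶠ z in 𝓝[≠] (0 : ℂ), z ≠ 0 :=
          (show ∀ᶠ z in 𝓝[≠] (0 : ℂ), z ≠ 0 from self_mem_nhdsWithin).frequently
        exact this.filter_mono nhdsWithin_le_nhds
      rwa [← hmap, frequently_map] at this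
    obtain ⟨τ, h0, h1, h2, h3⟩ :=
      (hne.and_eventually (htW.and ((hcont.eventually htW).and (hWg g hg hgP)))).exists
    rw [ht.invariant g hg, h1, h3, mul_pow] at h2
    have := add_left_cancel h2
    exact (mul_right_cancel₀ (pow_ne_zero n h0) (by rw [one_mul]; exact this)).symm

end IsHauptmodul

/-! ### Construction of the Hauptmodul -/

open Function.Periodic (qParam)

/-- `τ ↦ 3 τ`. -/
noncomputable def mulThree (τ : ℍ) : ℍ := ⟨3 * τ, by simp [τ.im_pos]⟩

theorem coe_mulThree (τ : ℍ) : (mulThree τ : ℂ) = 3 * τ := rfl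

theorem slash_action_level_one {k : ℤ} {F : Type*} [FunLike F ℍ ℂ] [SlashInvariantFormClass F 𝒮ℒ k]
    (f : F) (γ : SL(2, ℤ)) (τ : ℍ) : f (toReal γ • τ) = (γ 1 0 * τ + γ 1 1 : ℂ) ^ k * f τ := by
  have hmem : toReal γ ∈ 𝒮ℒ := ⟨γ, rfl⟩
  have := SlashInvariantForm.slash_action_eqn' f hmem τ
  rw [toReal_apply] at this
  exact this

theorem slash_action_S {k : ℤ} {F : Type*} [FunLike F ℍ ℂ] [SlashInvariantFormClass F 𝒮ℒ k]
    (f : F) (τ : ℍ) : f (ModularGroup.S • τ) = (τ : ℂ) ^ k * f τ := by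
  have h := slash_action_level_one f ModularGroup.S τ
  have h0 : ((ModularGroup.S 1 0 : ℤ) : ℂ) = 1 := by simp [ModularGroup.S]
  have h1 : ((ModularGroup.S 1 1 : ℤ) : ℂ) = 0 := by simp [ModularGroup.S]
  rw [h0, h1, one_mul, add_zero] at h
  exact h

theorem coe_S_smul (τ : ℍ) : ((ModularGroup.S • τ : ℍ) : ℂ) = -1 / τ := by
  rw [modular_S_smul]
  change (-(τ : ℂ))⁻¹ = _
  rw [inv_neg, neg_div, one_div]

theorem W_smul_eq (τ : ℍ) : W 3 • τ = ModularGroup.S • mulThree τ := by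
  apply UpperHalfPlane.ext
  rw [coe_W_smul, coe_S_smul, coe_mulThree]

theorem mulThree_W_smul (τ : ℍ) : mulThree (W 3 • τ) = ModularGroup.S • τ := by
  apply UpperHalfPlane.ext
  rw [coe_mulThree, coe_W_smul, coe_S_smul]
  have := τ.ne_zero
  field_simp

/-- Conjugation by `diag(3, 1)` carries `Γ₀(3)` into `SL₂(ℤ)`, without changing the automorphy
factor. -/
theorem slash_action_mulThree {k : ℤ} {F : Type*} [FunLike F ℍ ℂ] [SlashInvariantFormClass F 𝒮ℒ k]
    (f : F) {γ : SL(2, ℤ)} (hγ : γ ∈ Gamma0 3) (τ : ℍ) :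
    f (mulThree (toReal γ • τ)) = (γ 1 0 * τ + γ 1 1 : ℂ) ^ k * f (mulThree τ) := by
  obtain ⟨c, hc⟩ := (ZMod.intCast_zmod_eq_zero_iff_dvd _ 3).1 (Gamma0_mem.1 hγ)
  have hdet := γ.det_coe
  rw [Matrix.det_fin_two, hc] at hdet
  obtain ⟨δ, hδ⟩ : ∃ δ : SL(2, ℤ),
      (δ : Matrix (Fin 2) (Fin 2) ℤ) = !![γ 0 0, 3 * γ 0 1; c, γ 1 1] :=
    ⟨⟨!![γ 0 0, 3 * γ 0 1; c, γ 1 1], by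
      rw [Matrix.det_fin_two_of]; push_cast at hdet; linarith⟩, rfl⟩
  have : mulThree (toReal γ • τ) = toReal δ • mulThree τ := by
    apply UpperHalfPlane.ext
    have e1 := coe_specialLinearGroup_apply γ τ
    have e2 := coe_specialLinearGroup_apply δ (mulThree τ)
    rw [hc] at e1
    rw [hδ, coe_mulThree] at e2
    refine (congrArg (3 * ·) e1).trans (Eq.trans ?_ e2.symm)
    simp
    rw [← mul_div_assoc]
    congr 1 <;> ring
  rw [this, slash_action_level_one, hδ, hc, coe_mulThree]
  simp
  left
  congr 2
  ring

/-- `Δ(τ) Δ(3 τ)`. -/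
noncomputable def discr (τ : ℍ) : ℂ := discriminant τ * discriminant (mulThree τ)

theorem discr_ne_zero (τ : ℍ) : discr τ ≠ 0 :=
  mul_ne_zero (discriminant_ne_zero _) (discriminant_ne_zero _)

/-- `(E₄(τ) - E₄(3 τ)) (E₄(τ) - 81 E₄(3 τ))`. -/
noncomputable def formEight (τ : ℍ) : ℂ :=
  (E₄ τ - E₄ (mulThree τ)) * (E₄ τ - 81 * E₄ (mulThree τ))

/-- An invariant function with a simple pole at the cusp, holomorphic on `ℍ`. -/
noncomputable def hauptmodul (τ : ℍ) : ℂ := formEight τ ^ 3 / discr τ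

theorem denom_toReal (γ : SL(2, ℤ)) (τ : ℍ) : denom (toReal γ) τ = γ 1 0 * τ + γ 1 1 := by
  rw [denom, toReal_apply]; simp

theorem denom_mul {p : ℕ} [Fact p.Prime] (g : GL (Fin 2) ℝ) {h : GL (Fin 2) ℝ}
    (hh : h ∈ Gamma0Star p) (τ : ℍ) :
    denom (g * h) τ = denom g ↑(h • τ) * denom h τ := by
  have hdet : 0 < h.det.val := det_pos hh
  rw [denom_cocycle_σ, σ, if_pos hdet]
  rfl

theorem discriminant_smul (γ : SL(2, ℤ)) (τ : ℍ) :
    discriminant (toReal γ • τ) = denom (toReal γ) τ ^ 12 * discriminant τ := by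
  rw [denom_toReal]
  exact_mod_cast slash_action_level_one CuspForm.discriminant γ τ

theorem discriminant_mulThree_smul {γ : SL(2, ℤ)} (hγ : γ ∈ Gamma0 3) (τ : ℍ) :
    discriminant (mulThree (toReal γ • τ)) =
      denom (toReal γ) τ ^ 12 * discriminant (mulThree τ) := by
  rw [denom_toReal]
  exact_mod_cast slash_action_mulThree CuspForm.discriminant hγ τ

theorem discriminant_S_smul (τ : ℍ) :
    discriminant (ModularGroup.S • τ) = (τ : ℂ) ^ 12 * discriminant τ := by
  exact_mod_cast slash_action_S CuspForm.discriminant τ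

theorem E₄_smul (γ : SL(2, ℤ)) (τ : ℍ) :
    E₄ (toReal γ • τ) = denom (toReal γ) τ ^ 4 * E₄ τ := by
  rw [denom_toReal]
  exact_mod_cast slash_action_level_one E₄ γ τ

theorem E₄_mulThree_smul {γ : SL(2, ℤ)} (hγ : γ ∈ Gamma0 3) (τ : ℍ) :
    E₄ (mulThree (toReal γ • τ)) = denom (toReal γ) τ ^ 4 * E₄ (mulThree τ) := by
  rw [denom_toReal]
  exact_mod_cast slash_action_mulThree E₄ hγ τ

theorem E₄_S_smul (τ : ℍ) : E₄ (ModularGroup.S • τ) = (τ : ℂ) ^ 4 * E₄ τ := by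
  exact_mod_cast slash_action_S E₄ τ

/-- `W 3` exchanges the two factors, up to powers of `τ` and the constant `3¹² = √3²⁴`. -/
theorem discr_smul {g : GL (Fin 2) ℝ} (hg : g ∈ Gamma0Star 3) (τ : ℍ) :
    discr (g • τ) = denom g τ ^ 24 * discr τ := by
  have hsq : (√(3 : ℝ) : ℂ) * √3 = 3 := by
    rw [← Complex.ofReal_mul, Real.mul_self_sqrt (by norm_num)]; simp
  have h24 : (√(3 : ℝ) : ℂ) ^ 24 = 3 ^ 12 := by
    rw [show (24 : ℕ) = 2 * 12 by norm_num, pow_mul, sq, hsq]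
  have hΓ : ∀ γ ∈ Gamma0 3, ∀ τ : ℍ, discr (toReal γ • τ) = denom (toReal γ) τ ^ 24 * discr τ := by
    intro γ hγ τ
    rw [discr, discriminant_smul, discriminant_mulThree_smul hγ, discr]
    ring
  have hW : ∀ τ : ℍ, discr (W 3 • τ) = denom (W 3) τ ^ 24 * discr τ := by
    intro τ
    rw [discr, mulThree_W_smul, W_smul_eq, discriminant_S_smul, discriminant_S_smul, denom_W,
      coe_mulThree, mul_pow, mul_pow, h24, discr]
    ring
  obtain ⟨γ, hγ, rfl⟩ | ⟨γ, hγ, rfl⟩ := hg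
  · exact hΓ γ hγ τ
  · rw [mul_smul, hΓ γ hγ, hW, denom_mul _ (W_mem_Gamma0Star 3)]
    ring

/-- `W 3` takes `E₄(τ)` to `81 τ⁴ E₄(3τ)` and `E₄(3τ)` to `τ⁴ E₄(τ)`, so it exchanges the two
factors of `formEight` up to constants and powers of `τ`; the two signs cancel. This is the reason
for the coefficient 81. -/
theorem hauptmodul_invariant : Invariant hauptmodul := by
  have hΓ : ∀ γ ∈ Gamma0 3, ∀ τ : ℍ, hauptmodul (toReal γ • τ) = hauptmodul τ := by
    intro γ hγ τ
    have h3 : formEight (toReal γ • τ) = denom (toReal γ) τ ^ 8 * formEight τ := by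
      rw [formEight, E₄_smul, E₄_mulThree_smul hγ, formEight]
      ring
    rw [hauptmodul, discr_smul (toReal_mem_Gamma0Star hγ), h3, hauptmodul, mul_pow, ← pow_mul]
    exact mul_div_mul_left _ _ (pow_ne_zero _ (denom_ne_zero (toReal γ) τ))
  have hW : ∀ τ : ℍ, hauptmodul (W 3 • τ) = hauptmodul τ := by
    intro τ
    rw [hauptmodul, formEight, discr, mulThree_W_smul, W_smul_eq, discriminant_S_smul,
      discriminant_S_smul, E₄_S_smul, E₄_S_smul, hauptmodul, coe_mulThree, discr, formEight]
    have hτ := τ.ne_zero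
    have h5 := discriminant_ne_zero τ
    have h6 := discriminant_ne_zero (mulThree τ)
    generalize discriminant τ = a at *
    generalize discriminant (mulThree τ) = b at *
    generalize E₄ τ = c at *
    generalize E₄ (mulThree τ) = d at *
    rw [div_eq_div_iff (by simp [hτ, h5, h6]) (by simp [h5, h6])]
    ring
  rintro g (⟨γ, hγ, rfl⟩ | ⟨γ, hγ, rfl⟩) τ
  · exact hΓ γ hγ τ
  · rw [mul_smul, hΓ γ hγ, hW]

theorem holomorphic_of_mdiff {F : ℍ → ℂ} (hF : MDiff F) : Holomorphic F := fun τ ↦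
  (UpperHalfPlane.mdifferentiable_iff.1 hF).analyticAt (isOpen_upperHalfPlaneSet.mem_nhds τ.im_pos)

theorem Holomorphic.comp_mulThree {F : ℍ → ℂ} (hF : Holomorphic F) :
    Holomorphic fun τ ↦ F (mulThree τ) := by
  intro τ
  have h := (hF (mulThree τ)).comp_of_eq (f := fun z : ℂ ↦ 3 * z) (by fun_prop) (coe_mulThree τ).symm
  refine h.congr ?_
  filter_upwards [isOpen_upperHalfPlaneSet.mem_nhds τ.im_pos] with z hz
  have hz : 0 < z.im := hz
  have h3 : 0 < (3 * z).im := by simp [hz]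
  simp only [Function.comp_apply, ofComplex_apply_of_im_pos hz, ofComplex_apply_of_im_pos h3]
  rfl

theorem holomorphic_E₄ : Holomorphic E₄ := holomorphic_of_mdiff (ModularFormClass.holo E₄)

theorem holomorphic_discriminant : Holomorphic discriminant :=
  holomorphic_of_mdiff (CuspFormClass.holo CuspForm.discriminant)

theorem holomorphic_discr : Holomorphic discr := fun τ ↦
  (holomorphic_discriminant τ).mul (holomorphic_discriminant.comp_mulThree τ)

theorem holomorphic_hauptmodul : Holomorphic hauptmodul := fun τ ↦ by
  have h1 := holomorphic_E₄ τ
  have h2 := holomorphic_E₄.comp_mulThree τ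
  refine AnalyticAt.div (((h1.sub h2).mul (h1.sub (analyticAt_const.mul h2))).pow 3)
    (holomorphic_discr τ) (discr_ne_zero _)

/-! ### Expansions at the cusp -/

/-- `F` has the expansion `φ` in terms of `q`. -/
def HasExpansion (F : ℍ → ℂ) (φ : ℂ → ℂ) : Prop := ∀ τ : ℍ, F τ = φ (qParam 1 τ)

theorem hasExpansion_cuspFunction {F : ℍ → ℂ}
    (h : Function.Periodic (F ∘ ofComplex) (1 : ℝ)) : HasExpansion F (cuspFunction 1 F) :=
  fun τ ↦ (eq_cuspFunction τ one_ne_zero h).symm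

theorem qParam_mulThree (τ : ℍ) : qParam 1 (mulThree τ) = qParam 1 τ ^ 3 := by
  rw [qParam, qParam, coe_mulThree, ← Complex.exp_nat_mul]
  congr 1
  push_cast
  ring

theorem HasExpansion.comp_mulThree {F : ℍ → ℂ} {φ : ℂ → ℂ} (h : HasExpansion F φ) :
    HasExpansion (fun τ ↦ F (mulThree τ)) fun q ↦ φ (q ^ 3) := fun τ ↦
  (h (mulThree τ)).trans (by rw [qParam_mulThree])

theorem hasExpansion_E₄ : HasExpansion E₄ (cuspFunction 1 E₄) :=
  hasExpansion_cuspFunction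
    (SlashInvariantFormClass.periodic_comp_ofComplex E₄ one_mem_strictPeriods_SL)

theorem hasExpansion_discriminant : HasExpansion discriminant (cuspFunction 1 discriminant) :=
  hasExpansion_cuspFunction
    (SlashInvariantFormClass.periodic_comp_ofComplex CuspForm.discriminant one_mem_strictPeriods_SL)

theorem analyticAt_cuspFunction_E₄ : AnalyticAt ℂ (cuspFunction 1 E₄) 0 :=
  ModularFormClass.analyticAt_cuspFunction_zero E₄ one_pos one_mem_strictPeriods_SL

theorem analyticAt_cuspFunction_discriminant : AnalyticAt ℂ (cuspFunction 1 discriminant) 0 :=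
  ModularFormClass.analyticAt_cuspFunction_zero CuspForm.discriminant one_pos
    one_mem_strictPeriods_SL

theorem cuspFunction_E₄_zero : cuspFunction 1 E₄ 0 = 1 := by
  have := EisensteinSeries.E_qExpansion_coeff_zero (k := 4) (by norm_num) ⟨2, rfl⟩
  rw [qExpansion_coeff] at this
  simpa using this

theorem deriv_cuspFunction_E₄_zero : deriv (cuspFunction 1 E₄) 0 = 240 := by
  have := E₄_qExpansion_coeff_one
  rw [qExpansion_coeff] at this
  simpa using this

theorem cuspFunction_discriminant_zero : cuspFunction 1 discriminant 0 = 0 :=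
  CuspFormClass.cuspFunction_apply_zero CuspForm.discriminant one_pos one_mem_strictPeriods_SL

theorem deriv_cuspFunction_discriminant_zero : deriv (cuspFunction 1 discriminant) 0 = 1 := by
  have := discriminant_qExpansion_coeff_one
  rw [qExpansion_coeff] at this
  simpa using this

theorem meromorphicOrderAt_eq_one {φ : ℂ → ℂ} {z : ℂ} (h : AnalyticAt ℂ φ z) (h0 : φ z = 0)
    (h1 : deriv φ z ≠ 0) : meromorphicOrderAt φ z = 1 := by
  have := h.analyticOrderAt_sub_eq_one_of_deriv_ne_zero h1
  rw [h0] at this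
  simp only [sub_zero] at this
  rw [h.meromorphicOrderAt_eq, this]
  rfl

theorem tendsto_pow_nhdsNE {n : ℕ} (hn : n ≠ 0) :
    Tendsto (fun q : ℂ ↦ q ^ n) (𝓝[≠] 0) (𝓝[≠] 0) := by
  refine tendsto_nhdsWithin_of_tendsto_nhds_of_eventually_within _ ?_ ?_
  · exact ((continuous_pow n).tendsto' _ _ (zero_pow hn)).mono_left nhdsWithin_le_nhds
  · filter_upwards [self_mem_nhdsWithin] with q hq
    exact pow_ne_zero n hq

theorem meromorphicOrderAt_comp_pow {φ : ℂ → ℂ} (h : AnalyticAt ℂ φ 0) {n : ℕ} (hn : n ≠ 0)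
    {m : ℤ} (hm : meromorphicOrderAt φ 0 = m) :
    meromorphicOrderAt (fun q ↦ φ (q ^ n)) 0 = (m * n : ℤ) := by
  have h' : AnalyticAt ℂ (fun q ↦ φ (q ^ n)) 0 :=
    AnalyticAt.comp_of_eq (f := fun q : ℂ ↦ q ^ n) h (by fun_prop) (zero_pow hn)
  obtain ⟨g, hg, hg0, hgφ⟩ := (meromorphicOrderAt_eq_int_iff h.meromorphicAt).1 hm
  refine (meromorphicOrderAt_eq_int_iff h'.meromorphicAt).2 ⟨fun q ↦ g (q ^ n),
    AnalyticAt.comp_of_eq (f := fun q : ℂ ↦ q ^ n) hg (by fun_prop) (zero_pow hn),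
    by simpa [zero_pow hn] using hg0, ?_⟩
  filter_upwards [(tendsto_pow_nhdsNE hn).eventually hgφ] with q hq
  rw [hq, sub_zero, sub_zero, mul_comm m, zpow_mul, zpow_natCast]

/-- The expansion of `discr`. -/
noncomputable def discrExpansion (q : ℂ) : ℂ :=
  cuspFunction 1 discriminant q * cuspFunction 1 discriminant (q ^ 3)

theorem hasExpansion_discr : HasExpansion discr discrExpansion := fun τ ↦ by
  have : discriminant (mulThree τ) = cuspFunction 1 discriminant (qParam 1 τ ^ 3) :=
    hasExpansion_discriminant.comp_mulThree τ
  rw [discr, discrExpansion, hasExpansion_discriminant, this]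

/-- `Δ(τ)` contributes 1 and `Δ(3τ)` contributes 3. -/
theorem meromorphicOrderAt_discrExpansion : meromorphicOrderAt discrExpansion 0 = 4 := by
  have h := analyticAt_cuspFunction_discriminant
  have h1 : meromorphicOrderAt (cuspFunction 1 discriminant) 0 = (1 : ℤ) :=
    meromorphicOrderAt_eq_one h cuspFunction_discriminant_zero
      (by rw [deriv_cuspFunction_discriminant_zero]; exact one_ne_zero)
  have h3 := meromorphicOrderAt_comp_pow h three_ne_zero h1
  have h' : AnalyticAt ℂ (fun q ↦ cuspFunction 1 discriminant (q ^ 3)) 0 :=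
    AnalyticAt.comp_of_eq (f := fun q : ℂ ↦ q ^ 3) h (by fun_prop) (by simp)
  have := meromorphicOrderAt_mul h.meromorphicAt h'.meromorphicAt
  rw [h1, h3] at this
  exact this

theorem meromorphicAt_discrExpansion : MeromorphicAt discrExpansion 0 :=
  meromorphicAt_of_meromorphicOrderAt_ne_zero
    (by rw [meromorphicOrderAt_discrExpansion]; exact four_ne_zero)

/-- The expansion of `hauptmodul`. -/
noncomputable def hauptmodulExpansion (q : ℂ) : ℂ :=
  ((cuspFunction 1 E₄ q - cuspFunction 1 E₄ (q ^ 3)) *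
    (cuspFunction 1 E₄ q - 81 * cuspFunction 1 E₄ (q ^ 3))) ^ 3 / discrExpansion q

theorem hasExpansion_hauptmodul : HasExpansion hauptmodul hauptmodulExpansion := fun τ ↦ by
  have : E₄ (mulThree τ) = cuspFunction 1 E₄ (qParam 1 τ ^ 3) :=
    hasExpansion_E₄.comp_mulThree τ
  rw [hauptmodul, formEight, hauptmodulExpansion, hasExpansion_discr, hasExpansion_E₄, this]

/-- The first factor of `formEight` starts with `240 q`, the second with `1 - 81 ≠ 0`; the cube has
order 3 and the denominator order 4. -/
theorem meromorphicOrderAt_hauptmodulExpansion : meromorphicOrderAt hauptmodulExpansion 0 = -1 := by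
  have h := analyticAt_cuspFunction_E₄
  have h' : AnalyticAt ℂ (fun q ↦ cuspFunction 1 E₄ (q ^ 3)) 0 :=
    AnalyticAt.comp_of_eq (f := fun q : ℂ ↦ q ^ 3) h (by fun_prop) (by simp)
  have hd' : deriv (fun q ↦ cuspFunction 1 E₄ (q ^ 3)) 0 = 0 := by
    have h1 : HasDerivAt (fun q : ℂ ↦ q ^ 3) 0 0 := by simpa using hasDerivAt_pow 3 (0 : ℂ)
    have h2 : HasDerivAt (cuspFunction 1 E₄) 240 ((0 : ℂ) ^ 3) := by
      rw [zero_pow three_ne_zero, ← deriv_cuspFunction_E₄_zero]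
      exact h.differentiableAt.hasDerivAt
    have h3 : deriv (fun q ↦ cuspFunction 1 E₄ (q ^ 3)) 0 = 240 * 0 := (h2.comp 0 h1).deriv
    rw [h3, mul_zero]
  have h1 : meromorphicOrderAt (fun q ↦ cuspFunction 1 E₄ q - cuspFunction 1 E₄ (q ^ 3)) 0 = 1 := by
    refine meromorphicOrderAt_eq_one (h.sub h') (by simp) ?_
    have : deriv (fun q ↦ cuspFunction 1 E₄ q - cuspFunction 1 E₄ (q ^ 3)) 0 = 240 - 0 := by
      refine (deriv_sub h.differentiableAt h'.differentiableAt).trans ?_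
      rw [deriv_cuspFunction_E₄_zero, hd']
    rw [this]
    norm_num
  have h2a : AnalyticAt ℂ (fun q ↦ cuspFunction 1 E₄ q - 81 * cuspFunction 1 E₄ (q ^ 3)) 0 :=
    h.sub (analyticAt_const.mul h')
  have h2 : meromorphicOrderAt
      (fun q ↦ cuspFunction 1 E₄ q - 81 * cuspFunction 1 E₄ (q ^ 3)) 0 = 0 := by
    rw [h2a.meromorphicOrderAt_eq, h2a.analyticOrderAt_eq_zero.2]
    · rfl
    · rw [zero_pow three_ne_zero, cuspFunction_E₄_zero]
      norm_num
  have h3 := meromorphicOrderAt_mul (h.sub h').meromorphicAt h2a.meromorphicAt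
  have h4 := meromorphicOrderAt_pow ((h.sub h').meromorphicAt.mul h2a.meromorphicAt) (n := 3)
  have h5 := meromorphicOrderAt_div (((h.sub h').meromorphicAt.mul h2a.meromorphicAt).pow 3)
    meromorphicAt_discrExpansion
  rw [h4, h3, meromorphicOrderAt_discrExpansion, h2] at h5
  refine h5.trans ?_
  have h1' : meromorphicOrderAt (cuspFunction 1 E₄ - fun q ↦ cuspFunction 1 E₄ (q ^ 3)) 0 = 1 := h1
  rw [h1']
  rfl

theorem qParam_tendsto_nhdsNE :
    Tendsto (fun τ : ℍ ↦ qParam 1 τ) atImInfty (𝓝[≠] 0) :=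
  (Function.Periodic.qParam_tendsto one_pos).comp tendsto_coe_atImInfty

theorem orbit_eq_of_qParam_eq {p : ℕ} [Fact p.Prime] {σ τ : ℍ} (h : qParam 1 σ = qParam 1 τ) :
    orbit p σ = orbit p τ := by
  rw [qParam, qParam, Complex.exp_eq_exp_iff_exists_int] at h
  obtain ⟨n, hn⟩ := h
  obtain ⟨g, hg, hgt⟩ := exists_translation p n
  refine orbit_eq_iff.2 ⟨g, hg, ?_⟩
  rw [hgt]
  apply UpperHalfPlane.ext
  rw [coe_vadd]
  have := Complex.two_pi_I_ne_zero
  have h2 : (2 * Real.pi * Complex.I) * (σ - τ - n : ℂ) = 0 := by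
    simp only [Complex.ofReal_one, div_one] at hn
    linear_combination hn
  have h3 := (mul_eq_zero.1 h2).resolve_left this
  push_cast
  linear_combination -h3

/-- Near `q = 0` the function `1 / ψ` equals `q / g(q)`, with nonzero derivative at 0, so `t`
determines `q`, and `q` determines `τ` up to integer translation. -/
theorem isHauptmodul_of_expansion {t : ℍ → ℂ} {ψ : ℂ → ℂ} (hinv : Invariant t)
    (hol : Holomorphic t) (h : HasExpansion t ψ) (hψ : meromorphicOrderAt ψ 0 = -1) :
    IsHauptmodul t where
  invariant := hinv
  holomorphic := hol
  tendsto_norm := by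
    have h1 := tendsto_cobounded_of_meromorphicOrderAt_neg (f := ψ) (x := 0)
      (by rw [hψ]; exact WithTop.coe_lt_coe.2 (neg_one_lt_zero (R := ℤ)))
    have h2 := tendsto_norm_atTop_iff_cobounded.2 (h1.comp qParam_tendsto_nhdsNE)
    exact h2.congr fun τ ↦ by rw [h τ]; rfl
  injective_near_cusp := by
    have hm : MeromorphicAt ψ 0 := meromorphicAt_of_meromorphicOrderAt_ne_zero
      (by rw [hψ]; exact (WithTop.coe_lt_coe.2 (neg_one_lt_zero (R := ℤ))).ne)
    obtain ⟨g, hg, hg0, hgψ⟩ := (meromorphicOrderAt_eq_int_iff (n := -1) hm).1 hψ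
    have hd : HasDerivAt (fun q ↦ q / g q) (1 / g 0) 0 := by
      have := (hasDerivAt_id (0 : ℂ)).div hg.differentiableAt.hasDerivAt hg0
      simp only [id, one_mul, zero_mul, sub_zero] at this
      convert! this using 1
      field_simp
    have han : AnalyticAt ℂ (fun q ↦ q / g q) 0 := analyticAt_id.div hg hg0
    have hs : HasStrictDerivAt (fun q ↦ q / g q) (1 / g 0) 0 := by
      have := han.hasStrictDerivAt
      rwa [hd.deriv] at this
    have hne : 1 / g 0 ≠ 0 := one_div_ne_zero hg0
    have hev : ∀ᶠ q in 𝓝[≠] (0 : ℂ), hs.localInverse _ _ _ hne ((ψ q)⁻¹) = q := by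
      filter_upwards [hgψ, nhdsWithin_le_nhds (hs.eventually_left_inverse hne)] with q hq hq'
      rw [hq, sub_zero, smul_eq_mul, zpow_neg_one, mul_inv, inv_inv, ← div_eq_mul_inv, hq']
    obtain ⟨Y, hY⟩ := (atImInfty_mem _).1 (qParam_tendsto_nhdsNE.eventually hev)
    refine ⟨Y, fun τ τ' hτ hτ' htt ↦ orbit_eq_of_qParam_eq ?_⟩
    have h1 : hs.localInverse _ _ _ hne ((ψ (qParam 1 τ))⁻¹) = qParam 1 τ := hY τ hτ.le
    have h2 : hs.localInverse _ _ _ hne ((ψ (qParam 1 τ'))⁻¹) = qParam 1 τ' := hY τ' hτ'.le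
    rw [← h τ] at h1
    rw [← h τ', ← htt] at h2
    exact h1.symm.trans h2

theorem isHauptmodul_hauptmodul : IsHauptmodul hauptmodul :=
  isHauptmodul_of_expansion hauptmodul_invariant holomorphic_hauptmodul hasExpansion_hauptmodul
    meromorphicOrderAt_hauptmodulExpansion

/-! ### Multiplicities of the values of a Hauptmodul -/

theorem Invariant.meromorphicOrderAt_sub_eq {t : ℍ → ℂ} (ht : Invariant t) (c : ℂ) {P Q : ℍ}
    (h : orbit 3 P = orbit 3 Q) :
    meromorphicOrderAt (fun z ↦ t (ofComplex z) - c) P =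
      meromorphicOrderAt (fun z ↦ t (ofComplex z) - c) Q := by
  obtain ⟨g, hg, rfl⟩ := orbit_eq_iff.1 h
  rw [← meromorphicOrderAt_comp_smul (f := fun τ ↦ t τ - c) (det_pos hg)]
  simp only [ht g hg]

namespace IsHauptmodul

variable {t : ℍ → ℂ}

theorem exists_meromorphicOrderAt_iff (ht : IsHauptmodul t) (P : ℍ) : ∃ n : ℕ, n ≠ 0 ∧
    meromorphicOrderAt (fun z ↦ t (ofComplex z) - t P) P = (n : ℤ) ∧
    ∀ ζ : ℂ, ζ ^ n = 1 ↔ ∃ g ∈ Gamma0Star 3, g • P = P ∧ ζ = (denom g P ^ 2)⁻¹ := by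
  obtain ⟨n, hn, hord, h⟩ := ht.exists_order_iff P
  refine ⟨n, hn, ?_, h⟩
  have han : AnalyticAt ℂ (fun z ↦ t (ofComplex z) - t P) P :=
    (ht.holomorphic P).sub analyticAt_const
  rw [han.meromorphicOrderAt_eq, hord]
  rfl

/-- The multipliers of the stabilizer are exactly the `n`-th roots of unity. They satisfy `ζ² = 1`,
so `n ∣ 2`, and -1 occurs among them, so `2 ∣ n`. -/
theorem order_i₃ (ht : IsHauptmodul t) :
    meromorphicOrderAt (fun z ↦ t (ofComplex z) - t i₃) i₃ = (2 : ℤ) := by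
  obtain ⟨n, hn, hord, h⟩ := ht.exists_meromorphicOrderAt_iff i₃
  have h1 : n ∣ 2 := by
    have hp := Complex.isPrimitiveRoot_exp n hn
    obtain ⟨g, hg, hgP, hζ⟩ := (h _).1 hp.pow_eq_one
    refine hp.dvd_of_pow_eq_one 2 ?_
    rw [hζ, inv_pow, denom_sq_sq_of_smul_i₃ hg hgP, inv_one]
  have h2 : 2 ∣ n := by
    have hp : IsPrimitiveRoot (-1 : ℂ) 2 := IsPrimitiveRoot.neg_one 0 (by norm_num)
    refine hp.dvd_of_pow_eq_one n ((h _).2 ⟨W 3, W_mem_Gamma0Star 3, W_smul_i₃, ?_⟩)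
    rw [denom_W_i₃_sq]
    norm_num
  rw [hord, Nat.dvd_antisymm h1 h2]
  rfl

theorem order_ρ₃ (ht : IsHauptmodul t) :
    meromorphicOrderAt (fun z ↦ t (ofComplex z) - t ρ₃) ρ₃ = (6 : ℤ) := by
  obtain ⟨n, hn, hord, h⟩ := ht.exists_meromorphicOrderAt_iff ρ₃
  have h1 : n ∣ 6 := by
    have hp := Complex.isPrimitiveRoot_exp n hn
    obtain ⟨g, hg, hgP, hζ⟩ := (h _).1 hp.pow_eq_one
    refine hp.dvd_of_pow_eq_one 6 ?_
    rw [hζ, inv_pow, denom_sq_pow_six_of_smul_ρ₃ hg hgP, inv_one]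
  have h2 : 6 ∣ n := by
    obtain ⟨g, hg, hgP, hp⟩ := exists_primitive_denom_ρ₃
    exact hp.inv.dvd_of_pow_eq_one n ((h _).2 ⟨g, hg, hgP, rfl⟩)
  rw [hord, Nat.dvd_antisymm h1 h2]
  rfl

theorem order_of_ne (ht : IsHauptmodul t) {P : ℍ} (hi : orbit 3 P ≠ orbit 3 i₃)
    (hρ : orbit 3 P ≠ orbit 3 ρ₃) :
    meromorphicOrderAt (fun z ↦ t (ofComplex z) - t P) P = (1 : ℤ) := by
  obtain ⟨Q, hQ, hQP⟩ := exists_mem_fundDomain_orbit P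
  rw [ht.invariant.meromorphicOrderAt_sub_eq _ hQP.symm, ← ht.invariant.eq_of_orbit_eq hQP]
  obtain ⟨n, hn, hord, h⟩ := ht.exists_meromorphicOrderAt_iff Q
  have hp := Complex.isPrimitiveRoot_exp n hn
  obtain ⟨g, hg, hgP, hζ⟩ := (h _).1 hp.pow_eq_one
  rw [denom_sq_eq_one_of_mem_fundDomain hQ
    (fun g hg h ↦ hi (hQP.symm.trans (orbit_eq_iff.2 ⟨g, hg, h⟩)))
    (fun g hg h ↦ hρ (hQP.symm.trans (orbit_eq_iff.2 ⟨g, hg, h⟩))) hg hgP, inv_one] at hζ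
  rw [hζ] at hp
  rw [hord, hp.unique IsPrimitiveRoot.one]
  rfl

end IsHauptmodul

/-- The multiplicities 2 and 6 differ. -/
theorem orbit_i₃_ne_orbit_ρ₃ : orbit 3 i₃ ≠ orbit 3 ρ₃ := by
  intro h
  have ht := isHauptmodul_hauptmodul
  have := ht.order_i₃
  rw [ht.invariant.meromorphicOrderAt_sub_eq _ h, ht.invariant.eq_of_orbit_eq h, ht.order_ρ₃] at this
  exact absurd (WithTop.coe_injective this) (by norm_num)

open Classical in
/-- The order of the stabilizer of a point of the orbit `P`, modulo `±1`. -/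
noncomputable def ramification (P : MulAction.orbitRel.Quotient (Gamma0Star 3) ℍ) : ℕ :=
  if P = orbit 3 i₃ then 2 else if P = orbit 3 ρ₃ then 6 else 1

open Classical in
theorem IsHauptmodul.meromorphicOrderAt_sub {t : ℍ → ℂ} (ht : IsHauptmodul t) (P Q : ℍ) :
    meromorphicOrderAt (fun z ↦ t (ofComplex z) - t Q) P =
      ((if orbit 3 P = orbit 3 Q then ramification (orbit 3 P) else 0 : ℕ) : ℤ) := by
  split_ifs with h
  · rw [← ht.invariant.eq_of_orbit_eq h, ramification]
    split_ifs with h1 h2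
    · rw [ht.invariant.meromorphicOrderAt_sub_eq _ h1, ht.invariant.eq_of_orbit_eq h1, ht.order_i₃]
      rfl
    · rw [ht.invariant.meromorphicOrderAt_sub_eq _ h2, ht.invariant.eq_of_orbit_eq h2, ht.order_ρ₃]
      rfl
    · exact ht.order_of_ne h1 h2
  · have han : AnalyticAt ℂ (fun z ↦ t (ofComplex z) - t Q) P :=
      (ht.holomorphic P).sub analyticAt_const
    rw [han.meromorphicOrderAt_eq, han.analyticOrderAt_eq_zero.2]
    · rfl
    · rw [ofComplex_apply, sub_ne_zero]
      exact fun hPQ ↦ h (ht.orbit_eq_of_eq hPQ)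

/-! ### Invariant functions without zeros and poles on `ℍ` -/

/-- An invariant holomorphic function which vanishes at the cusp is zero. -/
theorem eq_zero_of_tendsto_zero {h : ℍ → ℂ} (hinv : Invariant h) (hol : Holomorphic h)
    (hlim : Tendsto h atImInfty (𝓝 0)) (τ : ℍ) : h τ = 0 := by
  by_contra hτ
  obtain ⟨Y, hY⟩ := (atImInfty_mem _).1
    (hlim.norm.eventually_lt_const (by rwa [norm_zero, norm_pos_iff] : ‖(0 : ℂ)‖ < ‖h τ‖))
  have hY : ∀ σ : ℍ, Y ≤ σ.im → ‖h σ‖ < ‖h τ‖ := hY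
  -- Values at least as large as `‖h τ‖` occur in the compact part of the fundamental domain, so the
  -- maximum there is global.
  have hmem : ∀ σ : ℍ, ‖h τ‖ ≤ ‖h σ‖ → ∃ σ' ∈ {σ : ℍ | σ ∈ fundDomain ∧ σ.im ≤ Y}, h σ' = h σ := by
    intro σ hσ
    obtain ⟨σ', h1, h2⟩ := exists_mem_fundDomain_orbit σ
    have h3 := hinv.eq_of_orbit_eq h2
    refine ⟨σ', ⟨h1, ?_⟩, h3⟩
    by_contra! h4
    exact absurd (hY σ' h4.le) (by rw [h3]; exact hσ.not_gt)
  obtain ⟨τ', hτ', hττ⟩ := hmem τ le_rfl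
  obtain ⟨m, -, hmax⟩ := (isCompact_fundDomain_le Y).exists_isMaxOn ⟨τ', hτ'⟩
    hol.continuous.norm.continuousOn
  have hm : ‖h τ‖ ≤ ‖h m‖ := by
    rw [← hττ]
    exact hmax hτ'
  have hglob : ∀ σ : ℍ, ‖h σ‖ ≤ ‖h m‖ := by
    intro σ
    rcases le_total ‖h σ‖ ‖h τ‖ with h1 | h1
    · exact h1.trans hm
    · obtain ⟨σ', h2, h3⟩ := hmem σ h1
      rw [← h3]
      exact hmax h2
  have hconst := Complex.eqOn_of_isPreconnected_of_isMaxOn_norm (f := fun z ↦ h (ofComplex z))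
    (convex_halfSpace_im_gt 0).isPreconnected isOpen_upperHalfPlaneSet
    (fun z hz ↦ (hol ⟨z, hz⟩).differentiableAt.differentiableWithinAt) m.im_pos (c := (m : ℂ))
    (fun z _ ↦ by
      change ‖h (ofComplex z)‖ ≤ ‖h (ofComplex m)‖
      rw [ofComplex_apply m]
      exact hglob _)
  have hcm : ∀ σ : ℍ, h σ = h m := fun σ ↦ by simpa using hconst σ.im_pos
  obtain ⟨σ, hσ⟩ : ∃ σ : ℍ, Y ≤ σ.im :=
    ⟨⟨Complex.I * (max Y 1 : ℝ), by simp⟩, by simp [← coe_im]⟩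
  have := hY σ hσ
  rw [hcm σ, hcm τ] at this
  exact lt_irrefl _ this

theorem eventually_nhdsNE_coe_iff {P : ℍ} {p : ℂ → Prop} :
    (∀ᶠ z in 𝓝[≠] (P : ℂ), p z) ↔ ∀ᶠ τ : ℍ in 𝓝[≠] P, p τ := by
  rw [eventually_nhdsWithin_iff, eventually_nhdsWithin_iff, eventually_nhds_coe_iff]
  simp

instance nhdsNE_neBot (P : ℍ) : (𝓝[≠] P).NeBot := by
  by_contra h
  rw [not_neBot] at h
  have h1 : ∀ᶠ z in 𝓝[≠] (P : ℂ), False := eventually_nhdsNE_coe_iff.2 (by rw [h]; exact eventually_bot)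
  exact h1.exists.elim fun _ h ↦ h

theorem tendsto_smul_nhdsNE (g : GL (Fin 2) ℝ) (P : ℍ) :
    Tendsto (g • · : ℍ → ℍ) (𝓝[≠] P) (𝓝[≠] (g • P)) :=
  tendsto_nhdsWithin_of_tendsto_nhds_of_eventually_within _
    (((continuous_const_smul g).tendsto P).mono_left nhdsWithin_le_nhds)
    (by filter_upwards [self_mem_nhdsWithin] with τ hτ using fun h ↦ hτ (MulAction.injective g h))

/-- Removal of the singularities of a meromorphic function of order zero everywhere. -/
theorem exists_holomorphic {F : ℍ → ℂ} (hinv : Invariant F)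
    (hF : ∀ τ : ℍ, MeromorphicAt (fun z ↦ F (ofComplex z)) τ)
    (hord : ∀ τ : ℍ, meromorphicOrderAt (fun z ↦ F (ofComplex z)) τ = 0) :
    ∃ h : ℍ → ℂ, Invariant h ∧ Holomorphic h ∧ (∀ τ, h τ ≠ 0) ∧
      ∀ P : ℍ, h =ᶠ[𝓝[≠] P] F := by
  have hF' : MeromorphicOn (fun z ↦ F (ofComplex z)) upperHalfPlaneSet := fun z hz ↦ hF ⟨z, hz⟩
  set H := toMeromorphicNFOn (fun z ↦ F (ofComplex z)) upperHalfPlaneSet with hH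
  have hnf : ∀ τ : ℍ, MeromorphicNFAt H τ := fun τ ↦ meromorphicNFOn_toMeromorphicNFOn _ _ τ.im_pos
  have hHord : ∀ τ : ℍ, meromorphicOrderAt H τ = 0 := fun τ ↦
    (meromorphicOrderAt_toMeromorphicNFOn hF' τ.im_pos).trans (hord τ)
  have heq : ∀ P : ℍ, (fun τ : ℍ ↦ H τ) =ᶠ[𝓝[≠] P] F := fun P ↦ by
    filter_upwards [eventually_nhdsNE_coe_iff.1 (hF'.toMeromorphicNFOn_eq_self_on_nhdsNE P.im_pos)]
      with τ hτ
    rw [ofComplex_apply] at hτ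
    exact hτ
  have hol : Holomorphic fun τ ↦ H τ := fun τ ↦ by
    refine ((hnf τ).meromorphicOrderAt_nonneg_iff_analyticAt.1 (hHord τ).ge).congr ?_
    filter_upwards [isOpen_upperHalfPlaneSet.mem_nhds τ.im_pos] with z hz
    rw [ofComplex_apply_of_im_pos hz]
  refine ⟨fun τ ↦ H τ, fun g hg τ ↦ ?_, hol,
    fun τ ↦ (hnf τ).meromorphicOrderAt_eq_zero_iff.1 (hHord τ), heq⟩
  have hc := hol.continuous
  -- `H` agrees with `F` only off a discrete set; its invariance at `τ` follows by continuity.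
  have h1 : Tendsto (fun σ : ℍ ↦ H (g • σ : ℍ)) (𝓝[≠] τ) (𝓝 (H (g • τ : ℍ))) :=
    ((hc.comp (continuous_const_smul g)).tendsto τ).mono_left nhdsWithin_le_nhds
  have h2 : Tendsto (fun σ : ℍ ↦ H σ) (𝓝[≠] τ) (𝓝 (H τ)) :=
    (hc.tendsto τ).mono_left nhdsWithin_le_nhds
  refine tendsto_nhds_unique h1 (h2.congr' ?_)
  filter_upwards [heq τ, (tendsto_smul_nhdsNE g τ).eventually (heq (g • τ))] with σ h3 h4
  rw [h3, h4, hinv g hg]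

/-- Otherwise the holomorphic version of `F` would tend to 0 at the cusp and vanish identically,
while it has no zeros. -/
theorem not_meromorphicOrderAt_pos {F : ℍ → ℂ} {φ : ℂ → ℂ} (hinv : Invariant F)
    (hF : ∀ τ : ℍ, MeromorphicAt (fun z ↦ F (ofComplex z)) τ)
    (hord : ∀ τ : ℍ, meromorphicOrderAt (fun z ↦ F (ofComplex z)) τ = 0)
    (hφ : HasExpansion F φ) : ¬ 0 < meromorphicOrderAt φ 0 := by
  intro hpos
  obtain ⟨h, h1, h2, h3, h4⟩ := exists_holomorphic hinv hF hord
  refine h3 i₃ (eq_zero_of_tendsto_zero h1 h2 ?_ i₃)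
  have hlim : Tendsto F atImInfty (𝓝 0) := by
    refine ((tendsto_zero_of_meromorphicOrderAt_pos hpos).comp qParam_tendsto_nhdsNE).congr ?_
    exact fun τ ↦ (hφ τ).symm
  rw [Metric.nhds_basis_closedBall.tendsto_right_iff] at hlim ⊢
  intro ε hε
  obtain ⟨Y, hY⟩ := (atImInfty_mem _).1 (hlim ε hε)
  -- The bound on `F` passes to `h τ` as a limit from nearby points, which must lie above `Y`; hence
  -- the margin.
  refine (atImInfty_mem _).2 ⟨Y + 1, fun τ hτ ↦ ?_⟩
  have hopen : ∀ᶠ σ : ℍ in 𝓝 τ, Y < σ.im :=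
    (continuous_im.tendsto τ).eventually_const_lt (by linarith)
  refine Metric.isClosed_closedBall.mem_of_tendsto
    ((h2.continuous.tendsto τ).mono_left (nhdsWithin_le_nhds (s := {τ}ᶜ))) ?_
  filter_upwards [h4 τ, nhdsWithin_le_nhds hopen] with σ h5 h6
  rw [h5]
  exact hY σ h6.le

/-- An invariant function without zeros and poles on `ℍ` has neither a zero nor a pole at the
cusp. -/
theorem meromorphicOrderAt_expansion_eq_zero {F : ℍ → ℂ} {φ : ℂ → ℂ} (hinv : Invariant F)
    (hF : ∀ τ : ℍ, MeromorphicAt (fun z ↦ F (ofComplex z)) τ)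
    (hord : ∀ τ : ℍ, meromorphicOrderAt (fun z ↦ F (ofComplex z)) τ = 0)
    (hφ : HasExpansion F φ) : meromorphicOrderAt φ 0 = 0 := by
  have h1 := not_meromorphicOrderAt_pos hinv hF hord hφ
  -- A pole at the cusp is a zero of the inverse function.
  have h2 := not_meromorphicOrderAt_pos (F := F⁻¹) (φ := φ⁻¹)
    (fun g hg τ ↦ by simp only [Pi.inv_apply, hinv g hg]) (fun τ ↦ (hF τ).inv)
    (fun τ ↦ (meromorphicOrderAt_inv (f := fun z ↦ F (ofComplex z))).trans (by rw [hord]; rfl))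
    (fun τ ↦ by simp only [Pi.inv_apply, hφ τ])
  rw [meromorphicOrderAt_inv] at h2
  generalize meromorphicOrderAt φ 0 = m at h1 h2
  induction m with
  | top => exact absurd (WithTop.coe_lt_top 0) h1
  | coe m =>
    have h1 : ¬ 0 < m := fun h ↦ h1 (WithTop.coe_lt_coe.2 h)
    have h2 : ¬ 0 < -m := fun h ↦ h2 (WithTop.coe_lt_coe.2 h)
    rw [show m = 0 by omega]
    rfl

end Fricke

/-! ### Orders of products of powers -/

theorem MeromorphicAt.zpow_mul_zpow_mul_prod {ι : Type*} {S : Finset ι} {A B : ℂ → ℂ}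
    {C : ι → ℂ → ℂ} {x : ℂ} (l n : ℤ) (m : ι → ℤ) (hA : MeromorphicAt A x)
    (hB : MeromorphicAt B x) (hC : ∀ i, MeromorphicAt (C i) x) :
    MeromorphicAt (fun z ↦ A z ^ l * B z ^ n * ∏ i ∈ S, C i z ^ m i) x :=
  ((hA.zpow l).mul (hB.zpow n)).mul (MeromorphicAt.fun_prod fun i _ ↦ (hC i).zpow (m i))

theorem meromorphicOrderAt_zpow_mul_zpow_mul_prod {ι : Type*} {S : Finset ι} {A B : ℂ → ℂ}
    {C : ι → ℂ → ℂ} {x : ℂ} {a b : ℤ} {c : ι → ℤ} (l n : ℤ) (m : ι → ℤ) (hA : MeromorphicAt A x)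
    (hB : MeromorphicAt B x) (hC : ∀ i, MeromorphicAt (C i) x) (ha : meromorphicOrderAt A x = a)
    (hb : meromorphicOrderAt B x = b) (hc : ∀ i, meromorphicOrderAt (C i) x = c i) :
    meromorphicOrderAt (fun z ↦ A z ^ l * B z ^ n * ∏ i ∈ S, C i z ^ m i) x =
      (l * a + n * b + ∑ i ∈ S, m i * c i : ℤ) := by
  have hz : ∀ {D : ℂ → ℂ} {d : ℤ} (k : ℤ), MeromorphicAt D x → meromorphicOrderAt D x = d →
      meromorphicOrderAt (D ^ k) x = (k * d : ℤ) := fun k hD hd ↦ by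
    rw [meromorphicOrderAt_zpow hD, hd]
    rfl
  have hP : MeromorphicAt (∏ i ∈ S, C i ^ m i) x :=
    MeromorphicAt.prod fun i _ ↦ (hC i).zpow (m i)
  have hPord : meromorphicOrderAt (∏ i ∈ S, C i ^ m i) x = (∑ i ∈ S, m i * c i : ℤ) := by
    rw [meromorphicOrderAt_prod fun i _ ↦ (hC i).zpow (m i), WithTop.coe_sum]
    exact Finset.sum_congr rfl fun i _ ↦ hz (m i) (hC i) (hc i)
  have h : (fun z ↦ A z ^ l * B z ^ n * ∏ i ∈ S, C i z ^ m i) =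
      A ^ l * B ^ n * ∏ i ∈ S, C i ^ m i := by
    ext z
    simp
  rw [h, meromorphicOrderAt_mul ((hA.zpow l).mul (hB.zpow n)) hP,
    meromorphicOrderAt_mul (hA.zpow l) (hB.zpow n), hz l hA ha, hz n hB hb, hPord]
  rfl

/-! ### The valence formula -/

namespace Fricke

open Function.Periodic (qParam)

theorem meromorphicAt_hauptmodulExpansion : MeromorphicAt hauptmodulExpansion 0 :=
  meromorphicAt_of_meromorphicOrderAt_ne_zero (by
    rw [meromorphicOrderAt_hauptmodulExpansion]
    exact (WithTop.coe_lt_coe.2 (neg_one_lt_zero (R := ℤ))).ne)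

theorem meromorphicOrderAt_hauptmodulExpansion_sub (c : ℂ) :
    meromorphicOrderAt (fun q ↦ hauptmodulExpansion q - c) 0 = (-1 : ℤ) := by
  classical
  have h1 : meromorphicOrderAt hauptmodulExpansion 0 < meromorphicOrderAt (fun _ : ℂ ↦ -c) 0 := by
    rw [meromorphicOrderAt_hauptmodulExpansion, meromorphicOrderAt_const]
    split_ifs
    · exact WithTop.coe_lt_top (-1)
    · exact WithTop.coe_lt_coe.2 (neg_one_lt_zero (R := ℤ))
  have h2 := meromorphicOrderAt_add_eq_left_of_lt (MeromorphicAt.const (-c) 0) h1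
  rw [meromorphicOrderAt_hauptmodulExpansion] at h2
  simp only [sub_eq_add_neg]
  exact h2

theorem meromorphicOrderAt_eq_zero {φ : ℂ → ℂ} {z : ℂ} (h : AnalyticAt ℂ φ z) (h0 : φ z ≠ 0) :
    meromorphicOrderAt φ z = 0 := by
  rw [h.meromorphicOrderAt_eq, h.analyticOrderAt_eq_zero.2 h0]
  rfl

namespace ModularFunction

theorem orderAtOrbit_orbit {p : ℕ} [Fact p.Prime] {k : ℤ} (f : ModularFunction p k) (τ : ℍ) :
    f.orderAtOrbit (orbit p τ) = f.orderAt τ := rfl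

theorem apply_smul {p : ℕ} [Fact p.Prime] {k : ℤ} (f : ModularFunction p k) {g : GL (Fin 2) ℝ}
    (hg : g ∈ Gamma0Star p) (τ : ℍ) : f.toFun (g • τ) = denom g τ ^ k * f.toFun τ := by
  have h := congrFun (f.slash_action_eq' g hg) τ
  have hd : g.det.val = 1 := det_eq_one hg
  rw [slash_def] at h
  simp only [UpperHalfPlane.σ, hd, one_pos, if_true, abs_one, Complex.ofReal_one, one_zpow,
    mul_one] at h
  rw [← h, zpow_neg]
  have := zpow_ne_zero k (denom_ne_zero g τ)
  field_simp
  simp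

theorem hasExpansion {p : ℕ} [Fact p.Prime] {k : ℤ} (f : ModularFunction p k) :
    HasExpansion f.toFun (cuspFunction 1 f.toFun) := by
  refine hasExpansion_cuspFunction
    (SlashInvariantFormClass.periodic_comp_ofComplex f.toSlashInvariantForm ?_)
  rw [Subgroup.mem_strictPeriods_iff]
  convert toReal_mem_Gamma0Star (T_zpow_mem_Gamma0 p 1)
  rw [zpow_one]
  ext i j
  rw [toReal_apply]
  fin_cases i <;> fin_cases j <;> simp [ModularGroup.T]

variable {k : ℤ} {f : ModularFunction 3 k}

/-- On the connected set `ℍ`, infinite order at one point spreads to all points. -/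
theorem orderAt_ne_top (hf : ¬ f.IsZero) (τ : ℍ) : f.orderAt τ ≠ ⊤ := by
  intro hτ
  have hm : MeromorphicOn (fun z ↦ f.toFun (ofComplex z)) upperHalfPlaneSet :=
    fun z hz ↦ f.meromorphic ⟨z, hz⟩
  refine hf ?_
  rw [IsZero, EventuallyEq, Filter.Eventually, mem_codiscrete]
  intro σ
  have hσ : meromorphicOrderAt (fun z ↦ f.toFun (ofComplex z)) σ = ⊤ := by
    by_contra h
    exact hm.meromorphicOrderAt_ne_top_of_isPreconnected
      (convex_halfSpace_im_gt 0).isPreconnected σ.im_pos τ.im_pos h hτ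
  rw [meromorphicOrderAt_eq_top_iff, eventually_nhdsNE_coe_iff] at hσ
  rw [disjoint_principal_right, compl_compl]
  filter_upwards [hσ] with ξ hξ
  rwa [ofComplex_apply] at hξ

theorem eventually_eq_cuspFunction (f : ModularFunction 3 k) (τ : ℍ) :
    (fun z ↦ f.toFun (ofComplex z)) =ᶠ[𝓝 (τ : ℂ)] fun z ↦ cuspFunction 1 f.toFun (qParam 1 z) := by
  filter_upwards [isOpen_upperHalfPlaneSet.mem_nhds τ.im_pos] with z hz
  rw [f.hasExpansion, ofComplex_apply_of_im_pos hz]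

theorem orderAtInfty_ne_top (hf : ¬ f.IsZero) : f.orderAtInfty ≠ ⊤ := by
  intro h
  rw [orderAtInfty, meromorphicOrderAt_eq_top_iff] at h
  obtain ⟨Y, hY⟩ := (atImInfty_mem _).1 (qParam_tendsto_nhdsNE.eventually h)
  obtain ⟨σ, hσ⟩ : ∃ σ : ℍ, Y < σ.im :=
    ⟨⟨Complex.I * (max Y 0 + 1 : ℝ), by simp; positivity⟩, by
      simp [← coe_im]; linarith [le_max_left Y 0]⟩
  refine orderAt_ne_top hf σ ?_
  rw [orderAt, meromorphicOrderAt_eq_top_iff, eventually_nhdsNE_coe_iff]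
  filter_upwards [nhdsWithin_le_nhds ((continuous_im.tendsto σ).eventually_const_lt hσ)] with τ hτ
  rw [ofComplex_apply, f.hasExpansion]
  exact hY τ hτ.le

theorem exists_orderAt_eq_zero (hf : ¬ f.IsZero) : ∃ Y : ℝ, ∀ τ : ℍ, Y ≤ τ.im → f.orderAt τ = 0 := by
  have h1 := f.meromorphic_infty.eventually_analyticAt
  have h2 := (meromorphicOrderAt_ne_top_iff_eventually_ne_zero f.meromorphic_infty).1
    (orderAtInfty_ne_top hf)
  obtain ⟨Y, hY⟩ := (atImInfty_mem _).1 (qParam_tendsto_nhdsNE.eventually (h1.and h2))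
  refine ⟨Y, fun τ hτ ↦ ?_⟩
  obtain ⟨h3, h4⟩ := hY τ hτ
  rw [orderAt, meromorphicOrderAt_congr
    ((f.eventually_eq_cuspFunction τ).filter_mono nhdsWithin_le_nhds)]
  refine meromorphicOrderAt_eq_zero (AnalyticAt.comp (f := qParam 1) h3 ?_) h4
  unfold qParam
  fun_prop

/-- The order vanishes high up in the fundamental domain, and its support is discrete, hence finite
on the compact remainder. -/
theorem finite_orderAtOrbit_ne_zero (hf : ¬ f.IsZero) : {P | f.orderAtOrbit P ≠ 0}.Finite := by
  obtain ⟨Y, hY⟩ := exists_orderAt_eq_zero hf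
  have hfin : ({τ : ℍ | τ ∈ fundDomain ∧ τ.im ≤ Y} ∩ {τ | f.orderAt τ ≠ 0}).Finite := by
    refine (isCompact_fundDomain_le Y).induction_on
      (p := fun s ↦ (s ∩ {τ | f.orderAt τ ≠ 0}).Finite) (by simp)
      (fun s t hst ht ↦ ht.subset (Set.inter_subset_inter_left _ hst))
      (fun s t hs ht ↦ by rw [Set.union_inter_distrib_right]; exact hs.union ht) ?_
    intro τ _
    have h1 := (f.meromorphic τ).eventually_analyticAt
    have h2 := (meromorphicOrderAt_ne_top_iff_eventually_ne_zero (f.meromorphic τ)).1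
      (orderAt_ne_top hf τ)
    have h3 : ∀ᶠ σ in 𝓝[≠] τ, f.orderAt σ = 0 := by
      refine (eventually_nhdsNE_coe_iff.1 (h1.and h2)).mono fun σ hσ ↦ ?_
      exact meromorphicOrderAt_eq_zero hσ.1 hσ.2
    refine ⟨_, nhdsWithin_le_nhds (eventually_nhdsWithin_iff.1 h3), (Set.finite_singleton τ).subset ?_⟩
    rintro σ ⟨hσ, hσ'⟩
    by_contra h
    exact hσ' (hσ h)
  refine (hfin.image (orbit 3)).subset fun P hP ↦ ?_
  obtain ⟨σ, rfl⟩ : ∃ σ, orbit 3 σ = P := Quotient.exists_rep P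
  obtain ⟨τ, hτ, hτσ⟩ := exists_mem_fundDomain_orbit σ
  rw [← hτσ] at hP ⊢
  refine ⟨τ, ⟨⟨hτ, ?_⟩, hP⟩, rfl⟩
  by_contra! h
  exact hP (hY τ h.le)

theorem ramification_mul (P : MulAction.orbitRel.Quotient (Gamma0Star 3) ℍ) :
    24 / ramification P * ramification P = 24 := by
  rw [ramification]
  split_ifs <;> norm_num

/-- The valence formula, multiplied by `24`. -/
theorem valence_formula (hf : ¬ f.IsZero)
    {S : Finset (MulAction.orbitRel.Quotient (Gamma0Star 3) ℍ)}
    (hS : ∀ P, f.orderAtOrbit P ≠ 0 → P ∈ S) :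
    24 * f.orderAtInfty.untop₀ +
      ∑ P ∈ S, ((24 / ramification P : ℕ) : ℤ) * (f.orderAtOrbit P).untop₀ = 4 * k := by
  classical
  have ht := isHauptmodul_hauptmodul
  obtain ⟨r, hr⟩ : ∃ r : MulAction.orbitRel.Quotient (Gamma0Star 3) ℍ → ℍ,
      ∀ P, orbit 3 (r P) = P :=
    ⟨fun P ↦ (Quotient.exists_rep P).choose, fun P ↦ (Quotient.exists_rep P).choose_spec⟩
  -- `t - t P` has order `ramification P` along the orbit `P`; as this divides 24, the exponent is
  -- an integer that cancels the order of `f²⁴` there.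
  set m : MulAction.orbitRel.Quotient (Gamma0Star 3) ℍ → ℤ :=
    fun P ↦ -(((24 / ramification P : ℕ) : ℤ) * (f.orderAtOrbit P).untop₀) with hm
  have hdisc : ∀ τ : ℍ, meromorphicOrderAt (fun z ↦ discr (ofComplex z)) τ = (0 : ℤ) := fun τ ↦
    meromorphicOrderAt_eq_zero (holomorphic_discr τ) (discr_ne_zero _)
  have hsub : ∀ τ P, MeromorphicAt (fun z ↦ hauptmodul (ofComplex z) - hauptmodul (r P)) (τ : ℍ) :=
    fun τ P ↦ ((ht.holomorphic τ).sub analyticAt_const).meromorphicAt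
  set F : ℍ → ℂ := fun τ ↦ f.toFun τ ^ (24 : ℤ) * discr τ ^ (-k) *
    ∏ P ∈ S, (hauptmodul τ - hauptmodul (r P)) ^ m P with hF
  set φ : ℂ → ℂ := fun q ↦ cuspFunction 1 f.toFun q ^ (24 : ℤ) * discrExpansion q ^ (-k) *
    ∏ P ∈ S, (hauptmodulExpansion q - hauptmodul (r P)) ^ m P with hφ
  have hinv : Invariant F := by
    intro g hg τ
    have hd := denom_ne_zero g τ
    have hone : (denom g τ ^ k) ^ (24 : ℤ) * (denom g τ ^ 24) ^ (-k) = 1 := by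
      rw [← zpow_mul, ← zpow_natCast, ← zpow_mul, ← zpow_add₀ hd, Nat.cast_ofNat,
        show k * 24 + 24 * -k = 0 by ring, zpow_zero]
    simp only [hF, ht.invariant g hg]
    rw [f.apply_smul hg, discr_smul hg, mul_zpow, mul_zpow, mul_mul_mul_comm, hone, one_mul]
  have hmer : ∀ τ : ℍ, MeromorphicAt (fun z ↦ F (ofComplex z)) τ := fun τ ↦
    MeromorphicAt.zpow_mul_zpow_mul_prod (A := fun z ↦ f.toFun (ofComplex z))
      (B := fun z ↦ discr (ofComplex z))
      (C := fun P z ↦ hauptmodul (ofComplex z) - hauptmodul (r P)) (24 : ℤ) (-k) m (f.meromorphic τ)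
      (holomorphic_discr τ).meromorphicAt (hsub τ)
  have hzero : ∀ τ : ℍ, meromorphicOrderAt (fun z ↦ F (ofComplex z)) τ = 0 := by
    intro τ
    refine (meromorphicOrderAt_zpow_mul_zpow_mul_prod (A := fun z ↦ f.toFun (ofComplex z))
      (B := fun z ↦ discr (ofComplex z))
      (C := fun P z ↦ hauptmodul (ofComplex z) - hauptmodul (r P)) (24 : ℤ) (-k) m (f.meromorphic τ)
      (holomorphic_discr τ).meromorphicAt (hsub τ)
      (WithTop.coe_untop₀_of_ne_top (orderAt_ne_top hf τ)).symm (hdisc τ)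
      (fun P ↦ ht.meromorphicOrderAt_sub τ (r P))).trans ?_
    rw [← WithTop.coe_zero]
    refine congrArg _ ?_
    -- Only the factor belonging to the orbit of `τ` contributes to the sum.
    simp only [hr, Nat.cast_ite, Nat.cast_zero, mul_ite, mul_zero, add_zero, Finset.sum_ite_eq]
    split_ifs with h
    · have := congrArg (Nat.cast (R := ℤ)) (ramification_mul (orbit 3 τ))
      rw [Nat.cast_mul] at this
      simp only [hm, orderAtOrbit_orbit]
      linear_combination -(f.orderAt τ).untop₀ * this
    · have : f.orderAt τ = 0 := by
        by_contra h'
        exact h (hS _ h')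
      rw [this]
      rfl
  have hexp : HasExpansion F φ := fun τ ↦ by
    simp only [hF, hφ, f.hasExpansion τ, hasExpansion_discr τ, hasExpansion_hauptmodul τ]
  -- At the cusp `discr` has order 4 and every `t - t P` has order -1.
  have hcusp : meromorphicOrderAt φ 0 = _ :=
    meromorphicOrderAt_zpow_mul_zpow_mul_prod (24 : ℤ) (-k) m f.meromorphic_infty
      meromorphicAt_discrExpansion
      (fun P ↦ meromorphicAt_hauptmodulExpansion.sub (MeromorphicAt.const (hauptmodul (r P)) 0))
      (WithTop.coe_untop₀_of_ne_top (orderAtInfty_ne_top hf)).symm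
      (b := 4) meromorphicOrderAt_discrExpansion (c := fun _ ↦ -1)
      (fun P ↦ meromorphicOrderAt_hauptmodulExpansion_sub (hauptmodul (r P)))
  have := WithTop.coe_injective
    (hcusp.symm.trans (meromorphicOrderAt_expansion_eq_zero hinv hmer hzero hexp))
  simp only [hm, mul_neg_one, neg_neg] at this
  linarith

end ModularFunction

end Fricke

theorem mainTheorem4 (k : ℤ) (f : Fricke.ModularFunction 3 k) (hf : ¬ f.IsZero) :
    -- all orders are finite, and only finitely many of them are nonzero
    f.orderAtInfty ≠ ⊤ ∧
    (∀ τ : ℍ, f.orderAt τ ≠ ⊤) ∧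
    {P : MulAction.orbitRel.Quotient (Fricke.Gamma0Star 3) ℍ | f.orderAtOrbit P ≠ 0}.Finite ∧
    -- the valence formula
    (f.orderAtInfty.untop₀ : ℚ)
      + 1 / 2 * (f.orderAt Fricke.i₃).untop₀
      + 1 / 6 * (f.orderAt Fricke.ρ₃).untop₀
      + ∑ᶠ (P : MulAction.orbitRel.Quotient (Fricke.Gamma0Star 3) ℍ)
          (_ : P ≠ Fricke.orbit 3 Fricke.i₃ ∧ P ≠ Fricke.orbit 3 Fricke.ρ₃),
          ((f.orderAtOrbit P).untop₀ : ℚ)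
      = (k : ℚ) / 6 := by
  classical
  have hfin := Fricke.ModularFunction.finite_orderAtOrbit_ne_zero hf
  refine ⟨Fricke.ModularFunction.orderAtInfty_ne_top hf, Fricke.ModularFunction.orderAt_ne_top hf,
    hfin, ?_⟩
  set i := Fricke.orbit 3 Fricke.i₃ with hi
  set ρ := Fricke.orbit 3 Fricke.ρ₃ with hρ
  have hne : i ≠ ρ := Fricke.orbit_i₃_ne_orbit_ρ₃
  set S := hfin.toFinset.filter fun P ↦ P ≠ i ∧ P ≠ ρ with hS
  have hmem : ∀ P, P ∈ S ↔ f.orderAtOrbit P ≠ 0 ∧ P ≠ i ∧ P ≠ ρ := by simp [hS]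
  have hsum : ∑ᶠ (P : MulAction.orbitRel.Quotient (Fricke.Gamma0Star 3) ℍ)
      (_ : P ≠ i ∧ P ≠ ρ), ((f.orderAtOrbit P).untop₀ : ℚ) =
      ∑ P ∈ S, ((f.orderAtOrbit P).untop₀ : ℚ) := by
    refine finsum_mem_eq_sum_of_inter_support_eq (s := {P | P ≠ i ∧ P ≠ ρ}) _ ?_
    ext P
    simp only [Set.mem_inter_iff, Set.mem_ofPred_eq, Finset.mem_coe, hmem, Function.mem_support,
      and_congr_left_iff]
    intro h
    have : f.orderAtOrbit P ≠ 0 := fun h' ↦ h (by rw [h']; rfl)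
    exact ⟨fun h ↦ ⟨this, h⟩, fun h ↦ h.2⟩
  -- Both elliptic orbits are inserted even if `f` has order 0 there, so that their terms, with
  -- coefficients `24 / 2` and `24 / 6`, can always be split off.
  have hval := Fricke.ModularFunction.valence_formula hf (S := insert i (insert ρ S)) fun P hP ↦ by
    rw [Finset.mem_insert, Finset.mem_insert, hmem]
    tauto
  have hram : ∀ P ∈ S, ((24 / Fricke.ramification P : ℕ) : ℤ) * (f.orderAtOrbit P).untop₀ =
      24 * (f.orderAtOrbit P).untop₀ := fun P hP ↦ by
    rw [Fricke.ramification, if_neg ((hmem P).1 hP).2.1, if_neg ((hmem P).1 hP).2.2]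
    rfl
  rw [Finset.sum_insert (by simp [hmem, hne]), Finset.sum_insert (by simp [hmem]),
    Finset.sum_congr rfl hram, ← Finset.mul_sum, Fricke.ramification, Fricke.ramification,
    if_pos hi, if_neg hne.symm, if_pos hρ, hi, hρ, Fricke.ModularFunction.orderAtOrbit_orbit,
    Fricke.ModularFunction.orderAtOrbit_orbit] at hval
  have hval := congrArg (Int.cast (R := ℚ)) hval
  push_cast at hval
  rw [hsum]
  linarith
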